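/- Let $\mathcal H$ be a complex Hilbert space, $\mathrm U(\mathcal H)$ its unitary group, with Lie algebra $\mathfrak u(\mathcal H)$ the skew-adjoint bounded operators, $\mathcal S_0\subseteq\mathcal H$ a closed subspace, and $p$ the orthogonal projection onto $\mathcal S_0$. Let $\mathrm{Gr}_{\mathcal S_0}(\mathcal H)=\{u\mathcal S_0\mid u\in \mathrm U(\mathcal H)\}$ be the connected component of $\mathcal S_0$ in the Grassmann manifold of closed subspaces of $\mathcal H$; the charts at $u\mathcal S_0$ are the inverses of the maps $A\mapsto u(\text{graph of }A)$, where $A$ runs over the bounded operators $\mathcal S_0\to\mathcal S_0^\perp$. Let $\mathcal T_{\mathcal S_0}(\mathcal H)=\{(\mathcal S,x)\mid \mathcal S\in \mathrm{Gr}_{\mathcal S_0}(\mathcal H),\ x\in\mathcal S\}$ be the tautological vector bundle over $\mathrm{Gr}_{\mathcal S_0}(\mathcal H)$. All smoothness is real $C^\infty$. For $u\in \mathrm U(\mathcal H)$, $X\in\mathfrak u(\mathcal H)$, $x,y\in\mathcal S_0$, let $[((u,X),(x,y))]\in T(\mathcal T_{\mathcal S_0}(\mathcal H))$ be the velocity at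 $t=0$ of the curve $t\mapsto (ue^{tX}\mathcal S_0,\ ue^{tX}(x+ty))$. All tangent vectors of $\mathcal T_{\mathcal S_0}(\mathcal H)$ are of this form. The universal connection is the map $\Phi$ on $T(\mathcal T_{\mathcal S_0}(\mathcal H))$ given by $$\Phi\big([((u,X),(x,y))]\big)=[((u,E_p(X)),(x,y))],\qquad E_p(X)=pXp+(1-p)X(1-p).$$ For $\mathcal S\in\mathrm{Gr}_{\mathcal S_0}(\mathcal H)$ and $x_1,x_2\in\mathcal S$ let $\varepsilon(\mathcal S;x_1,x_2)$ be the velocity at $t=0$ of the curve $t\mapsto(\mathcal S,x_1+tx_2)$, and let $r$ be the map defined on the vertical tangent vectors by $r(\varepsilon(\mathcal S;x_1,x_2))=(\mathcal S,x_2)$. The covariant derivative of a smooth section $\sigma$ is $\nabla\sigma=r\circ\Phi\circ T\sigma$, where $T\sigma$ is the tangent map of $\sigma$. **Proposition.** Let $\sigma$ be a smooth section of $\mathcal T_{\mathcal S_0}(\mathcal H)$ defined on an open set $U\subseteq\mathrm{Gr}_{\mathcal S_0}(\mathcal H)$ (for instance $U=\mathrm{Gr}_{\mathcal S_0}(\mathcal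 H)$). Then there is a unique function $F_\sigma:U\to\mathcal H$ such that $\sigma(\mathcal S)=(\mathcal S,F_\sigma(\mathcal S))$ for all $\mathcal S\in U$; this function is smooth, and $$\nabla\sigma(X)=\big(\mathcal S,\ p_{\mathcal S}(\mathrm dF_\sigma(X))\big)\qquad\text{for all }\mathcal S\in U,\ X\in T_{\mathcal S}(\mathrm{Gr}_{\mathcal S_0}(\mathcal H)),$$ where $p_{\mathcal S}$ is the orthogonal projection of $\mathcal H$ onto $\mathcal S$. -/

import Mathlib

open Bundle Set Filter Topology Manifold ContDiff

set_option linter.unusedSectionVars false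

noncomputable section

namespace HilbertGrassmann

variable {H : Type*} [NormedAddCommGroup H] [InnerProductSpace ℂ H] [CompleteSpace H]

instance instCompleteToSubmodule (S : ClosedSubmodule ℂ H) : CompleteSpace S.toSubmodule :=
  instCompleteSpaceSubtypeMemClosedSubmodule S

/-- The unitary group of `H`. -/
abbrev UnitaryGroup (H : Type*) [NormedAddCommGroup H] [InnerProductSpace ℂ H]
    [CompleteSpace H] : Type _ := unitary (H →L[ℂ] H)

/-! ### Polar decomposition, and unitary operators moving `S₀` to a graph -/

lemma star_coe_apply (u : UnitaryGroup H) (x : H) :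
    (star (u : H →L[ℂ] H)) ((u : H →L[ℂ] H) x) = x :=
  congrArg (fun T : H →L[ℂ] H => T x) (Unitary.coe_star_mul_self u)

lemma coe_star_apply (u : UnitaryGroup H) (x : H) :
    (u : H →L[ℂ] H) ((star (u : H →L[ℂ] H)) x) = x :=
  congrArg (fun T : H →L[ℂ] H => T x) (Unitary.coe_mul_star_self u)

variable (S₀ : ClosedSubmodule ℂ H)

/-- The connected component of `S₀` in the Grassmannian of closed subspaces of `H`, that is, the orbit
`{u S₀ | u ∈ U(H)}` of `S₀` under the unitary group. -/
structure Gr where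
  /-- The closed subspace. -/
  space : ClosedSubmodule ℂ H
  exists_unitary : ∃ u : UnitaryGroup H,
    space.toSubmodule = S₀.toSubmodule.map ((u : H →L[ℂ] H) : H →ₗ[ℂ] H)

/-- Bounded operators from `S₀` to its orthogonal complement, the model space of the Grassmannian. -/
abbrev Op : Type _ := S₀.toSubmodule →L[ℂ] S₀.toSubmoduleᗮ

/-! Shortcuts for instance search. -/

instance instNormedSpaceRealSub (S : Submodule ℂ H) : NormedSpace ℝ S := inferInstance

instance instModuleRealSub (S : Submodule ℂ H) : Module ℝ S := (instNormedSpaceRealSub S).toModule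

instance instNormedSpaceRealOp : NormedSpace ℝ (Op S₀) := inferInstance

/-- The parametrization `x ↦ x + A x` of the graph of `A`. -/
def graphMap (A : Op S₀) : S₀.toSubmodule →L[ℂ] H :=
  S₀.toSubmodule.subtypeL + S₀.toSubmoduleᗮ.subtypeL ∘L A

/-- Orthogonal projection onto `S₀`. -/
def pr : H →L[ℂ] S₀.toSubmodule := S₀.toSubmodule.orthogonalProjectionOnto

/-- Orthogonal projection onto the orthogonal complement of `S₀`. -/
def prPerp : H →L[ℂ] S₀.toSubmoduleᗮ := S₀.toSubmoduleᗮ.orthogonalProjectionOnto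

variable {S₀}

@[simp] lemma pr_coe (x : S₀.toSubmodule) : pr S₀ (x : H) = x := by simp [pr]
@[simp] lemma pr_coe_perp (x : S₀.toSubmoduleᗮ) : pr S₀ (x : H) = 0 := by simp [pr]
@[simp] lemma prPerp_coe (x : S₀.toSubmodule) : prPerp S₀ (x : H) = 0 :=
  Submodule.orthogonalProjectionOnto_orthogonal_apply_eq_zero x.2
@[simp] lemma prPerp_coe_perp (x : S₀.toSubmoduleᗮ) : prPerp S₀ (x : H) = x := by simp [prPerp]

lemma graphMap_apply (A : Op S₀) (x : S₀.toSubmodule) :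
    graphMap S₀ A x = (x : H) + (A x : H) := rfl

@[simp] lemma pr_graphMap (A : Op S₀) (x : S₀.toSubmodule) : pr S₀ (graphMap S₀ A x) = x := by
  simp [graphMap_apply]

@[simp] lemma prPerp_graphMap (A : Op S₀) (x : S₀.toSubmodule) :
    prPerp S₀ (graphMap S₀ A x) = A x := by
  simp [graphMap_apply]

lemma pr_add_prPerp (x : H) : (pr S₀ x : H) + (prPerp S₀ x : H) = x :=
  S₀.toSubmodule.starProjection_add_starProjection_orthogonal x

lemma inner_coe_left (x : S₀.toSubmodule) (y : H) : inner ℂ (x : H) y = inner ℂ x (pr S₀ y) := by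
  rw [Submodule.coe_inner]
  conv_lhs => rw [← pr_add_prPerp (S₀ := S₀) y]
  rw [inner_add_right, Submodule.inner_right_of_mem_orthogonal x.2 (prPerp S₀ y).2, add_zero]

lemma inner_coe_perp_left (x : S₀.toSubmoduleᗮ) (y : H) :
    inner ℂ (x : H) y = inner ℂ x (prPerp S₀ y) := by
  rw [Submodule.coe_inner]
  conv_lhs => rw [← pr_add_prPerp (S₀ := S₀) y]
  rw [inner_add_right, Submodule.inner_left_of_mem_orthogonal (pr S₀ y).2 x.2, zero_add]

lemma inner_coe_right (x : S₀.toSubmodule) (y : H) : inner ℂ y (x : H) = inner ℂ (pr S₀ y) x := by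
  rw [← inner_conj_symm, inner_coe_left, inner_conj_symm]

lemma inner_coe_perp_right (x : S₀.toSubmoduleᗮ) (y : H) :
    inner ℂ y (x : H) = inner ℂ (prPerp S₀ y) x := by
  rw [← inner_conj_symm, inner_coe_perp_left, inner_conj_symm]

/-- The skew-adjoint operator on `H` with off-diagonal blocks `A` and `-A*`. -/
def skewBlock (A : Op S₀) : H →L[ℂ] H :=
  S₀.toSubmoduleᗮ.subtypeL ∘L A ∘L pr S₀
    - S₀.toSubmodule.subtypeL ∘L (ContinuousLinearMap.adjoint A) ∘L prPerp S₀

lemma skewBlock_apply (A : Op S₀) (x : H) :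
    skewBlock A x = (A (pr S₀ x) : H) - ((ContinuousLinearMap.adjoint A) (prPerp S₀ x) : H) := rfl

lemma star_skewBlock (A : Op S₀) : star (skewBlock A) = - skewBlock A := by
  rw [ContinuousLinearMap.star_eq_adjoint]
  symm
  rw [ContinuousLinearMap.eq_adjoint_iff]
  intro x y
  rw [neg_apply, inner_neg_left, skewBlock_apply, skewBlock_apply, inner_sub_left,
    inner_sub_right, inner_coe_left, inner_coe_right, inner_coe_perp_left, inner_coe_perp_right,
    ContinuousLinearMap.adjoint_inner_left, ContinuousLinearMap.adjoint_inner_right]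
  ring

lemma one_add_skewBlock_coe (A : Op S₀) (x : S₀.toSubmodule) :
    (1 + skewBlock A) (x : H) = graphMap S₀ A x := by
  simp [skewBlock_apply, graphMap_apply]

lemma isUnit_one_add_skewBlock (A : Op S₀) : IsUnit (1 + skewBlock A) := by
  have hstar : star (1 + skewBlock A) = 1 - skewBlock A := by
    rw [star_add, star_skewBlock, star_one]; abel
  have hz : star (1 + skewBlock A) * (1 + skewBlock A) = 1 + star (skewBlock A) * skewBlock A := by
    rw [hstar, star_skewBlock]; noncomm_ring
  have hu : IsUnit (star (1 + skewBlock A) * (1 + skewBlock A)) := by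
    rw [hz]
    have h1 : (1 : H →L[ℂ] H) ≤ 1 + star (skewBlock A) * skewBlock A :=
      le_add_of_nonneg_right (star_mul_self_nonneg _)
    exact CStarAlgebra.isUnit_of_le 1 h1
  have hc : Commute (star (1 + skewBlock A)) (1 + skewBlock A) := by
    rw [hstar]
    change (1 - skewBlock A) * (1 + skewBlock A) = (1 + skewBlock A) * (1 - skewBlock A)
    noncomm_ring
  exact (hc.isUnit_mul_iff.mp hu).2

lemma commute_proj (A : Op S₀) :
    Commute (star (1 + skewBlock A) * (1 + skewBlock A)) S₀.toSubmodule.starProjection := by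
  have hP : ∀ x, S₀.toSubmodule.starProjection x = (pr S₀ x : H) := fun x => rfl
  have hstar : star (1 + skewBlock A) = 1 - skewBlock A := by
    rw [star_add, star_skewBlock, star_one]; abel
  have : star (1 + skewBlock A) * (1 + skewBlock A) = 1 - skewBlock A * skewBlock A := by
    rw [hstar]; noncomm_ring
  rw [this]
  refine (Commute.one_left _).sub_left ?_
  ext x
  change skewBlock A (skewBlock A (S₀.toSubmodule.starProjection x))
    = S₀.toSubmodule.starProjection (skewBlock A (skewBlock A x))
  rw [hP, hP]
  simp [skewBlock_apply]

/-- Polar decomposition of an invertible operator, compatible with commutants. -/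
lemma exists_polar (g P : H →L[ℂ] H) (hg : IsUnit g) (hP : Commute (star g * g) P) :
    ∃ (w : UnitaryGroup H) (c : (H →L[ℂ] H)ˣ), Commute (c : H →L[ℂ] H) P ∧
      (w : H →L[ℂ] H) * c = g := by
  have hnn : 0 ≤ star g * g := star_mul_self_nonneg g
  have hu : IsUnit (star g * g) := hg.star.mul hg
  have hcc := CFC.sqrt_mul_sqrt_self (star g * g) hnn
  have hcs := (IsSelfAdjoint.of_nonneg (CFC.sqrt_nonneg (star g * g))).star_eq
  have hcomm : Commute (CFC.sqrt (star g * g)) P := by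
    rw [CFC.sqrt_eq_cfc]
    exact hP.cfc_nnreal _
  obtain ⟨c, hc⟩ := (CFC.isUnit_sqrt_iff (star g * g) hnn).mpr hu
  rw [← hc] at hcc hcs hcomm
  obtain ⟨g, rfl⟩ := hg
  have hci : star (↑c⁻¹ : H →L[ℂ] H) = ↑c⁻¹ := by
    rw [← Units.coe_star_inv]
    congr 2
    exact Units.ext hcs
  have hw1 : star ((g * c⁻¹ : (H →L[ℂ] H)ˣ) : H →L[ℂ] H) * ((g * c⁻¹ : (H →L[ℂ] H)ˣ) : H →L[ℂ] H)
      = 1 := by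
    rw [Units.val_mul, star_mul, hci]
    calc (↑c⁻¹ : H →L[ℂ] H) * star (g : H →L[ℂ] H) * ((g : H →L[ℂ] H) * ↑c⁻¹)
        = ↑c⁻¹ * (star (g : H →L[ℂ] H) * g) * ↑c⁻¹ := by simp only [mul_assoc]
      _ = 1 := by
        rw [← hcc, ← mul_assoc, Units.inv_mul, one_mul, Units.mul_inv]
  have hw2 : ((g * c⁻¹ : (H →L[ℂ] H)ˣ) : H →L[ℂ] H) * star ((g * c⁻¹ : (H →L[ℂ] H)ˣ) : H →L[ℂ] H)
      = 1 := by
    rw [← Units.inv_eq_of_mul_eq_one_left hw1, Units.mul_inv]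
  exact ⟨⟨_, hw1, hw2⟩, c, hcomm, by simp⟩

lemma mem_of_commute {T : H →L[ℂ] H} (hT : Commute T S₀.toSubmodule.starProjection) {x : H}
    (hx : x ∈ S₀.toSubmodule) : T x ∈ S₀.toSubmodule := by
  have h1 : T (S₀.toSubmodule.starProjection x) = S₀.toSubmodule.starProjection (T x) :=
    congrArg (fun T : H →L[ℂ] H => T x) hT.eq
  rw [Submodule.starProjection_eq_self_iff.mpr hx] at h1
  exact Submodule.starProjection_eq_self_iff.mp h1.symm

lemma exists_unitary_graph (A : Op S₀) :
    ∃ w : UnitaryGroup H, (graphMap S₀ A).range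
      = S₀.toSubmodule.map ((w : H →L[ℂ] H) : H →ₗ[ℂ] H) := by
  obtain ⟨w, c, hc, hwc⟩ := exists_polar _ _ (isUnit_one_add_skewBlock A) (commute_proj A)
  refine ⟨w, ?_⟩
  ext z
  constructor
  · rintro ⟨x, rfl⟩
    refine ⟨(c : H →L[ℂ] H) x, mem_of_commute hc x.2, ?_⟩
    change ((w : H →L[ℂ] H) * c) x = graphMap S₀ A x
    rw [hwc, one_add_skewBlock_coe]
  · rintro ⟨x, hx, rfl⟩
    refine ⟨⟨(↑c⁻¹ : H →L[ℂ] H) x, mem_of_commute hc.units_inv_left hx⟩, ?_⟩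
    change graphMap S₀ A _ = (w : H →L[ℂ] H) x
    rw [← one_add_skewBlock_coe, ← hwc]
    change (w : H →L[ℂ] H) (((c : H →L[ℂ] H) * ↑c⁻¹) x) = _
    rw [Units.mul_inv]; rfl

/-! ### The manifold structure

For every unitary `u`, the map `A ↦ u (graph A)` is the inverse of a chart of the Grassmannian around
`u S₀`, with values in the bounded operators from `S₀` to its orthogonal complement. These charts
define the topology and the smooth structure. The lemmas of the previous section show that
`u (graph A)` is in the unitary orbit of `S₀`. -/

/-- The operator `x ↦ u (x + A x)`, whose range is `u (graph A)`. -/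
def frame (u : UnitaryGroup H) (A : Op S₀) : S₀.toSubmodule →L[ℂ] H :=
  (u : H →L[ℂ] H) ∘L graphMap S₀ A

lemma frame_apply (u : UnitaryGroup H) (A : Op S₀) (x : S₀.toSubmodule) :
    frame u A x = (u : H →L[ℂ] H) (graphMap S₀ A x) := rfl

@[simp] lemma pr_star_frame (u : UnitaryGroup H) (A : Op S₀) (x : S₀.toSubmodule) :
    pr S₀ (star (u : H →L[ℂ] H) (frame u A x)) = x := by
  rw [frame_apply, star_coe_apply, pr_graphMap]

@[simp] lemma prPerp_star_frame (u : UnitaryGroup H) (A : Op S₀) (x : S₀.toSubmodule) :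
    prPerp S₀ (star (u : H →L[ℂ] H) (frame u A x)) = A x := by
  rw [frame_apply, star_coe_apply, prPerp_graphMap]

lemma frame_injective (u : UnitaryGroup H) (A : Op S₀) : Function.Injective (frame u A) :=
  Function.LeftInverse.injective (g := fun z => pr S₀ (star (u : H →L[ℂ] H) z)) (pr_star_frame u A)

lemma exists_unitary_frame (u : UnitaryGroup H) (A : Op S₀) :
    ∃ w : UnitaryGroup H, (frame u A).range
      = S₀.toSubmodule.map ((w : H →L[ℂ] H) : H →ₗ[ℂ] H) := by
  obtain ⟨w, hw⟩ := exists_unitary_graph A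
  refine ⟨u * w, ?_⟩
  have h1 : (frame u A).range = (graphMap S₀ A).range.map ((u : H →L[ℂ] H) : H →ₗ[ℂ] H) := by
    ext z; simp [frame]
  rw [h1, hw, ← Submodule.map_comp]; rfl

lemma isClosed_range_frame (u : UnitaryGroup H) (A : Op S₀) :
    IsClosed ((frame u A).range : Set H) := by
  have : ((frame u A).range : Set H)
      = {z | frame u A (pr S₀ (star (u : H →L[ℂ] H) z)) = z} := by
    ext z
    constructor
    · rintro ⟨x, rfl⟩
      exact congrArg _ (pr_star_frame u A x)
    · intro h
      exact ⟨_, h⟩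
  rw [this]
  exact isClosed_eq (by fun_prop) continuous_id

/-- The point `u (graph A)` of the Grassmannian. -/
def chartPoint (u : UnitaryGroup H) (A : Op S₀) : Gr S₀ :=
  ⟨⟨(frame u A).range, isClosed_range_frame u A⟩, exists_unitary_frame u A⟩

lemma Gr.ext {S T : Gr S₀} (h : S.space.toSubmodule = T.space.toSubmodule) : S = T := by
  cases S; cases T
  congr
  exact ClosedSubmodule.toSubmodule_injective h

lemma chartPoint_eq_iff (u v : UnitaryGroup H) (A B : Op S₀) :
    chartPoint u A = chartPoint v B ↔ (frame u A).range = (frame v B).range :=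
  ⟨fun h => congrArg (fun S : Gr S₀ => S.space.toSubmodule) h, fun h => Gr.ext h⟩

lemma chartPoint_injective (u : UnitaryGroup H) :
    Function.Injective (chartPoint u : Op S₀ → Gr S₀) := by
  intro A B h
  rw [chartPoint_eq_iff] at h
  ext x
  obtain ⟨y, hy⟩ : frame u A x ∈ (frame u B).range := h ▸ ⟨x, rfl⟩
  have h1 := congrArg (fun z => pr S₀ (star (u : H →L[ℂ] H) z)) hy
  have h2 := congrArg (fun z => prPerp S₀ (star (u : H →L[ℂ] H) z)) hy
  have h1' : y = x := by simpa using h1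
  have h2' : B y = A x := by simpa using h2
  rw [← h2', h1']

/-- The chart inverse to `A ↦ u (graph A)`. -/
def chart (u : UnitaryGroup H) : PartialEquiv (Gr S₀) (Op S₀) where
  toFun := Function.invFun (chartPoint u)
  invFun := chartPoint u
  source := Set.range (chartPoint u)
  target := Set.univ
  map_source' _ _ := Set.mem_univ _
  map_target' A _ := ⟨A, rfl⟩
  left_inv' := by
    rintro _ ⟨A, rfl⟩
    rw [Function.leftInverse_invFun (chartPoint_injective u) A]
  right_inv' A _ := Function.leftInverse_invFun (chartPoint_injective u) A

@[simp] lemma chart_chartPoint (u : UnitaryGroup H) (A : Op S₀) : chart u (chartPoint u A) = A :=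
  (chart u).right_inv (Set.mem_univ A)

lemma chartPoint_chart (u : UnitaryGroup H) {S : Gr S₀} (hS : S ∈ (chart u).source) :
    chartPoint u (chart u S) = S :=
  (chart u).left_inv hS

/-- The block of the change of charts with values in `S₀`. -/
def transDen (u v : UnitaryGroup H) (A : Op S₀) : S₀.toSubmodule →L[ℂ] S₀.toSubmodule :=
  pr S₀ ∘L star (v : H →L[ℂ] H) ∘L frame u A

/-- The block of the change of charts with values in the orthogonal complement of `S₀`. -/
def transNum (u v : UnitaryGroup H) (A : Op S₀) : Op S₀ :=
  prPerp S₀ ∘L star (v : H →L[ℂ] H) ∘L frame u A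

lemma transDen_apply (u v : UnitaryGroup H) (A : Op S₀) (x : S₀.toSubmodule) :
    transDen u v A x = pr S₀ (star (v : H →L[ℂ] H) (frame u A x)) := rfl

lemma transNum_apply (u v : UnitaryGroup H) (A : Op S₀) (x : S₀.toSubmodule) :
    transNum u v A x = prPerp S₀ (star (v : H →L[ℂ] H) (frame u A x)) := rfl

lemma frame_eq_frame (u v : UnitaryGroup H) (A : Op S₀) (h : IsUnit (transDen u v A)) :
    frame u A = frame v (transNum u v A ∘L Ring.inverse (transDen u v A)) ∘L transDen u v A := by
  obtain ⟨a, ha⟩ := h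
  ext x
  have hx : Ring.inverse (transDen u v A) (transDen u v A x) = x := by
    change (Ring.inverse (transDen u v A) * transDen u v A) x = x
    rw [Ring.inverse_mul_cancel _ ⟨a, ha⟩]; rfl
  rw [ContinuousLinearMap.comp_apply, frame_apply v, graphMap_apply,
    ContinuousLinearMap.comp_apply, hx, transDen_apply, transNum_apply, pr_add_prPerp,
    coe_star_apply]

lemma chartPoint_eq_of_isUnit (u v : UnitaryGroup H) (A : Op S₀) (h : IsUnit (transDen u v A)) :
    chartPoint u A = chartPoint v (transNum u v A ∘L Ring.inverse (transDen u v A)) := by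
  rw [chartPoint_eq_iff]
  have h2 := frame_eq_frame u v A h
  have hs : Function.Surjective (transDen u v A) :=
    (ContinuousLinearMap.isUnit_iff_bijective.mp h).2
  ext z
  constructor
  · rintro ⟨x, rfl⟩
    exact ⟨transDen u v A x, (congrArg (fun T => T x) h2).symm⟩
  · rintro ⟨y, rfl⟩
    obtain ⟨x, rfl⟩ := hs y
    exact ⟨x, congrArg (fun T => T x) h2⟩

lemma isUnit_of_chartPoint_eq (u v : UnitaryGroup H) (A B : Op S₀)
    (h : chartPoint u A = chartPoint v B) : IsUnit (transDen u v A) := by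
  rw [chartPoint_eq_iff] at h
  rw [ContinuousLinearMap.isUnit_iff_bijective]
  constructor
  · intro x x' hx
    obtain ⟨y, hy⟩ : frame u A x ∈ (frame v B).range := h ▸ ⟨x, rfl⟩
    obtain ⟨y', hy'⟩ : frame u A x' ∈ (frame v B).range := h ▸ ⟨x', rfl⟩
    change frame v B y = _ at hy
    change frame v B y' = _ at hy'
    rw [transDen_apply, transDen_apply, ← hy, ← hy', pr_star_frame, pr_star_frame] at hx
    rw [hx, hy'] at hy
    exact (frame_injective u A hy).symm
  · intro y
    obtain ⟨x, hx⟩ : frame v B y ∈ (frame u A).range := h ▸ ⟨y, rfl⟩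
    change frame u A x = _ at hx
    exact ⟨x, by rw [transDen_apply, hx, pr_star_frame]⟩

lemma chart_trans_source (u v : UnitaryGroup H) :
    ((chart (S₀ := S₀) u).symm.trans (chart v)).source = {A | IsUnit (transDen u v A)} := by
  ext A
  simp only [PartialEquiv.trans_source, PartialEquiv.symm_source, mem_inter_iff, mem_preimage,
    Set.mem_ofPred_eq]
  constructor
  · rintro ⟨-, B, hB⟩
    exact isUnit_of_chartPoint_eq u v A B hB.symm
  · intro h
    exact ⟨Set.mem_univ _, _, (chartPoint_eq_of_isUnit u v A h).symm⟩

lemma chart_trans_apply (u v : UnitaryGroup H) (A : Op S₀) (h : IsUnit (transDen u v A)) :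
    chart v (chartPoint u A) = transNum u v A ∘L Ring.inverse (transDen u v A) := by
  rw [chartPoint_eq_of_isUnit u v A h, chart_chartPoint]

lemma contDiff_frame (u : UnitaryGroup H) {n : WithTop ℕ∞} :
    ContDiff ℂ n (fun A : Op S₀ => frame u A) :=
  contDiff_const.clm_comp (contDiff_const.add (contDiff_const.clm_comp contDiff_id))

lemma contDiff_transDen (u v : UnitaryGroup H) {n : WithTop ℕ∞} :
    ContDiff ℂ n (fun A : Op S₀ => transDen u v A) :=
  contDiff_const.clm_comp (contDiff_const.clm_comp (contDiff_frame u))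

lemma contDiff_transNum (u v : UnitaryGroup H) {n : WithTop ℕ∞} :
    ContDiff ℂ n (fun A : Op S₀ => transNum u v A) :=
  contDiff_const.clm_comp (contDiff_const.clm_comp (contDiff_frame u))

lemma contDiffOn_chart_trans (u v : UnitaryGroup H) {n : WithTop ℕ∞} :
    ContDiffOn ℝ n (fun A : Op S₀ => chart v (chartPoint u A)) {A | IsUnit (transDen u v A)} := by
  have h : ContDiffOn ℂ n (fun A : Op S₀ => transNum u v A ∘L Ring.inverse (transDen u v A))
      {A | IsUnit (transDen u v A)} := by
    intro A hA
    refine (ContDiffAt.clm_comp (contDiff_transNum u v).contDiffAt ?_).contDiffWithinAt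
    obtain ⟨a, ha⟩ := hA
    have h1 := contDiffAt_ringInverse ℂ (n := n) (R := S₀.toSubmodule →L[ℂ] S₀.toSubmodule) a
    rw [ha] at h1
    exact h1.comp A (contDiff_transDen u v).contDiffAt
  exact (h.restrict_scalars ℝ).congr fun A hA => chart_trans_apply u v A hA

lemma isOpen_isUnit_transDen (u v : UnitaryGroup H) :
    IsOpen {A : Op S₀ | IsUnit (transDen u v A)} :=
  (Units.isOpen (R := S₀.toSubmodule →L[ℂ] S₀.toSubmodule)).preimage
    (contDiff_transDen u v (n := 0)).continuous

/-- A unitary operator carrying `S₀` onto `S`. -/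
def moveTo (S : Gr S₀) : UnitaryGroup H := S.exists_unitary.choose

lemma frame_zero_range (u : UnitaryGroup H) :
    (frame u (0 : Op S₀)).range = S₀.toSubmodule.map ((u : H →L[ℂ] H) : H →ₗ[ℂ] H) := by
  ext z; simp [frame, graphMap]

lemma chartPoint_moveTo (S : Gr S₀) : chartPoint (moveTo S) 0 = S :=
  Gr.ext ((frame_zero_range _).trans S.exists_unitary.choose_spec.symm)

lemma mem_chart_moveTo (S : Gr S₀) : S ∈ (chart (moveTo S)).source := ⟨0, chartPoint_moveTo S⟩

variable (S₀) in
/-- The atlas of all the charts. -/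
def grCore : ChartedSpaceCore (Op S₀) (Gr S₀) where
  atlas := Set.range chart
  chartAt S := chart (moveTo S)
  mem_chart_source := mem_chart_moveTo
  chart_mem_atlas _ := ⟨_, rfl⟩
  open_source := by
    rintro _ _ ⟨u, rfl⟩ ⟨v, rfl⟩
    rw [chart_trans_source]
    exact isOpen_isUnit_transDen u v
  continuousOn_toFun := by
    rintro _ _ ⟨u, rfl⟩ ⟨v, rfl⟩
    rw [chart_trans_source]
    exact (contDiffOn_chart_trans u v (n := 0)).continuousOn

instance : TopologicalSpace (Gr S₀) := (grCore S₀).toTopologicalSpace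

instance : ChartedSpace (Op S₀) (Gr S₀) := (grCore S₀).toChartedSpace

/-- The charts, as local homeomorphisms. -/
def openChart (u : UnitaryGroup H) : OpenPartialHomeomorph (Gr S₀) (Op S₀) :=
  (grCore S₀).openPartialHomeomorph (chart u) ⟨u, rfl⟩

lemma openChart_mem_atlas (u : UnitaryGroup H) : openChart u ∈ atlas (Op S₀) (Gr S₀) := by
  refine mem_iUnion.mpr ⟨chart u, mem_iUnion.mpr ⟨⟨u, rfl⟩, rfl⟩⟩

lemma chartAt_eq (S : Gr S₀) : chartAt (Op S₀) S = openChart (moveTo S) := rfl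

instance : IsManifold 𝓘(ℝ, Op S₀) ∞ (Gr S₀) := by
  refine isManifold_of_contDiffOn _ _ _ ?_
  rintro e e' he he'
  obtain ⟨_, he⟩ := mem_iUnion.mp he
  obtain ⟨⟨u, rfl⟩, rfl⟩ := mem_iUnion.mp he
  obtain ⟨_, he'⟩ := mem_iUnion.mp he'
  obtain ⟨⟨v, rfl⟩, rfl⟩ := mem_iUnion.mp he'
  have h := contDiffOn_chart_trans (S₀ := S₀) u v (n := ∞)
  rw [← chart_trans_source] at h
  refine h.mono ?_
  rintro A ⟨hA, -⟩
  exact hA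

lemma isOpen_chart_source (u : UnitaryGroup H) : IsOpen (chart (S₀ := S₀) u).source :=
  (openChart u).open_source

lemma contMDiffOn_chart (u : UnitaryGroup H) :
    ContMDiffOn 𝓘(ℝ, Op S₀) 𝓘(ℝ, Op S₀) ∞ (chart (S₀ := S₀) u) (chart u).source :=
  contMDiffOn_of_mem_maximalAtlas (IsManifold.subset_maximalAtlas (openChart_mem_atlas u))

lemma contMDiff_chartPoint (u : UnitaryGroup H) :
    ContMDiff 𝓘(ℝ, Op S₀) 𝓘(ℝ, Op S₀) ∞ (chartPoint (S₀ := S₀) u) := by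
  rw [← contMDiffOn_univ]
  exact contMDiffOn_symm_of_mem_maximalAtlas
    (IsManifold.subset_maximalAtlas (openChart_mem_atlas (S₀ := S₀) u))

/-! ### The tautological bundle

The fiber over `S` is `S` itself. Over the domain of the chart of `u`, the bundle is trivialized by
`(u (graph A), u (x + A x)) ↦ x`. -/

/-- The fiber of the tautological bundle over `S` is `S`. -/
abbrev Fiber (S : Gr S₀) : Type _ := S.space.toSubmodule

/-- The total space `{(S, x) | x ∈ S}` of the tautological bundle. -/
abbrev Tot (S₀ : ClosedSubmodule ℂ H) : Type _ := TotalSpace S₀.toSubmodule (Fiber (S₀ := S₀))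

lemma frame_mem {u : UnitaryGroup H} {S : Gr S₀} (hS : S ∈ (chart u).source)
    (y : S₀.toSubmodule) : frame u (chart u S) y ∈ S.space.toSubmodule := by
  have h : (frame u (chart u S)).range = S.space.toSubmodule :=
    congrArg (fun S : Gr S₀ => S.space.toSubmodule) (chartPoint_chart u hS)
  rw [← h]
  exact ⟨y, rfl⟩

lemma frame_pr {u : UnitaryGroup H} {S : Gr S₀} (hS : S ∈ (chart u).source)
    {x : H} (hx : x ∈ S.space.toSubmodule) :
    frame u (chart u S) (pr S₀ (star (u : H →L[ℂ] H) x)) = x := by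
  have h : (frame u (chart u S)).range = S.space.toSubmodule :=
    congrArg (fun S : Gr S₀ => S.space.toSubmodule) (chartPoint_chart u hS)
  rw [← h] at hx
  obtain ⟨y, rfl⟩ := hx
  exact congrArg _ (pr_star_frame u _ y)

lemma coe_proj_frame {u : UnitaryGroup H} {S : Gr S₀} (hS : S ∈ (chart u).source)
    (y : S₀.toSubmodule) :
    (S.space.toSubmodule.orthogonalProjectionOnto (frame u (chart u S) y) : H)
      = frame u (chart u S) y :=
  congrArg Subtype.val
    (Submodule.orthogonalProjectionOnto_mem_subspace_eq_self ⟨_, frame_mem hS y⟩)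

/-- The local trivialization over the chart of `u`. -/
def trivial (u : UnitaryGroup H) :
    Pretrivialization S₀.toSubmodule (π S₀.toSubmodule (Fiber (S₀ := S₀))) where
  toFun d := (d.proj, pr S₀ (star (u : H →L[ℂ] H) (d.2 : H)))
  invFun q := ⟨q.1, q.1.space.toSubmodule.orthogonalProjectionOnto (frame u (chart u q.1) q.2)⟩
  source := TotalSpace.proj ⁻¹' (chart u).source
  target := (chart u).source ×ˢ univ
  map_source' _ hd := ⟨hd, Set.mem_univ _⟩
  map_target' _ hq := hq.1
  left_inv' := by
    rintro ⟨S, x⟩ hS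
    have hS' : S ∈ (chart u).source := hS
    congr 1
    dsimp only
    rw [frame_pr hS' x.2]
    exact Submodule.orthogonalProjectionOnto_mem_subspace_eq_self x
  right_inv' := by
    rintro ⟨S, y⟩ ⟨hS, -⟩
    have hS' : S ∈ (chart u).source := hS
    refine Prod.ext rfl ?_
    dsimp only
    rw [coe_proj_frame hS' y, pr_star_frame]
  open_target := (isOpen_chart_source u).prod isOpen_univ
  baseSet := (chart u).source
  open_baseSet := isOpen_chart_source u
  source_eq := rfl
  target_eq := rfl
  proj_toFun _ _ := rfl

lemma trivial_symm (u : UnitaryGroup H) {S : Gr S₀} (hS : S ∈ (chart u).source)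
    (y : S₀.toSubmodule) : (((trivial u).symm S y : Fiber S) : H) = frame u (chart u S) y := by
  have h : _ = (trivial u).toPartialEquiv.symm (S, y) := (trivial u).mk_symm (b := S) hS y
  exact (congrArg (fun d : Tot S₀ => (d.2 : H)) h).trans (coe_proj_frame hS y)

lemma contMDiffOn_coordChange (u v : UnitaryGroup H) :
    ContMDiffOn 𝓘(ℝ, Op S₀) 𝓘(ℝ, S₀.toSubmodule →L[ℝ] S₀.toSubmodule) ∞
      (fun S : Gr S₀ => (transDen u v (chart u S)).restrictScalars ℝ) (chart u).source := by
  have h0 : ContDiff ℝ ∞ (fun A : Op S₀ => transDen u v A) :=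
    (contDiff_transDen (S₀ := S₀) u v).restrict_scalars ℝ
  have h : ContDiff ℝ ∞ (fun A : Op S₀ => (transDen u v A).restrictScalars ℝ) :=
    (ContinuousLinearMap.restrictScalarsIsometry ℂ S₀.toSubmodule S₀.toSubmodule ℝ ℝ).contDiff.comp h0
  exact h.contMDiff.comp_contMDiffOn (contMDiffOn_chart u)

variable (S₀) in
/-- The tautological bundle, as a (real) vector bundle given by its local trivializations. -/
def tautPrebundle : VectorPrebundle ℝ S₀.toSubmodule (Fiber (S₀ := S₀)) where
  pretrivializationAtlas := Set.range trivial
  pretrivialization_linear' := by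
    rintro _ ⟨u, rfl⟩
    refine ⟨fun S _ => ⟨fun x y => ?_, fun c x => ?_⟩⟩
    · change pr S₀ (star (u : H →L[ℂ] H) ((x : H) + y)) = _
      rw [map_add, map_add]; rfl
    · change pr S₀ (star (u : H →L[ℂ] H) (c • (x : H))) = _
      rw [ContinuousLinearMap.map_smul_of_tower, ContinuousLinearMap.map_smul_of_tower]; rfl
  pretrivializationAt S := trivial (moveTo S)
  mem_base_pretrivializationAt S := mem_chart_moveTo S
  pretrivialization_mem_atlas S := ⟨_, rfl⟩
  exists_coordChange := by
    rintro _ ⟨u, rfl⟩ _ ⟨v, rfl⟩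
    refine ⟨fun S => (transDen u v (chart u S)).restrictScalars ℝ, ?_, ?_⟩
    · exact (contMDiffOn_coordChange u v).continuousOn.mono inter_subset_left
    · rintro S ⟨hS, hS'⟩ y
      change pr S₀ (star (v : H →L[ℂ] H) (frame u (chart u S) y))
        = pr S₀ (star (v : H →L[ℂ] H) ((trivial u).symm S y : Fiber S))
      rw [trivial_symm u hS]
  totalSpaceMk_isInducing S := by
    have h : IsInducing (fun x : Fiber S => pr S₀ (star (moveTo S : H →L[ℂ] H) (x : H))) := by
      refine (Function.LeftInverse.isEmbedding
        (f := fun y => S.space.toSubmodule.orthogonalProjectionOnto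
          (frame (moveTo S) (chart (moveTo S) S) y)) ?_ (by fun_prop) (by fun_prop)).isInducing
      intro x
      dsimp only
      rw [frame_pr (mem_chart_moveTo S) x.2]
      exact Submodule.orthogonalProjectionOnto_mem_subspace_eq_self x
    exact isInducing_const_prod.mpr h

instance : TopologicalSpace (Tot S₀) := (tautPrebundle S₀).totalSpaceTopology

instance : FiberBundle S₀.toSubmodule (Fiber (S₀ := S₀)) := (tautPrebundle S₀).toFiberBundle

instance : VectorBundle ℝ S₀.toSubmodule (Fiber (S₀ := S₀)) := (tautPrebundle S₀).toVectorBundle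

instance : (tautPrebundle S₀).IsContMDiff 𝓘(ℝ, Op S₀) ∞ where
  exists_contMDiffCoordChange := by
    rintro _ ⟨u, rfl⟩ _ ⟨v, rfl⟩
    refine ⟨fun S => (transDen u v (chart u S)).restrictScalars ℝ,
      (contMDiffOn_coordChange u v).mono inter_subset_left, ?_⟩
    rintro S ⟨hS, hS'⟩ y
    change pr S₀ (star (v : H →L[ℂ] H) (frame u (chart u S) y))
      = pr S₀ (star (v : H →L[ℂ] H) ((trivial u).symm S y : Fiber S))
    rw [trivial_symm u hS]

instance : ContMDiffVectorBundle ∞ S₀.toSubmodule (Fiber (S₀ := S₀)) 𝓘(ℝ, Op S₀) :=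
  (tautPrebundle S₀).contMDiffVectorBundle 𝓘(ℝ, Op S₀)

/-! ### The universal connection and its covariant derivative -/

/-- The (real) model of the Grassmannian. -/
abbrev grModel (S₀ : ClosedSubmodule ℂ H) : ModelWithCorners ℝ (Op S₀) (Op S₀) := 𝓘(ℝ, Op S₀)

/-- The (real) model of the total space of the tautological bundle. -/
abbrev totModel (S₀ : ClosedSubmodule ℂ H) :
    ModelWithCorners ℝ (Op S₀ × S₀.toSubmodule) (ModelProd (Op S₀) S₀.toSubmodule) :=
  (grModel S₀).prod 𝓘(ℝ, S₀.toSubmodule)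

/-- `E_p(X) = p X p + (1 - p) X (1 - p)`, where `p` is the orthogonal projection onto `S₀`. -/
def condExp (S₀ : ClosedSubmodule ℂ H) (X : H →L[ℂ] H) : H →L[ℂ] H :=
  S₀.toSubmodule.starProjection * X * S₀.toSubmodule.starProjection
    + (1 - S₀.toSubmodule.starProjection) * X * (1 - S₀.toSubmodule.starProjection)

/-- The Lie algebra of the unitary group: the skew-adjoint operators. -/
abbrev LieAlg (H : Type*) [NormedAddCommGroup H] [InnerProductSpace ℂ H]
    [CompleteSpace H] : Type _ := skewAdjoint (H →L[ℂ] H)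

lemma condExp_mem (X : LieAlg H) : condExp S₀ (X : H →L[ℂ] H) ∈ skewAdjoint (H →L[ℂ] H) := by
  have hP : star S₀.toSubmodule.starProjection = S₀.toSubmodule.starProjection :=
    (isSelfAdjoint_starProjection S₀.toSubmodule).star_eq
  have hX : star (X : H →L[ℂ] H) = - X := X.2
  rw [skewAdjoint.mem_iff, condExp]
  simp only [star_add, star_mul, star_sub, star_one, hP, hX]
  noncomm_ring

/-- `E_p` on the Lie algebra of the unitary group. -/
def condExpLie (S₀ : ClosedSubmodule ℂ H) (X : LieAlg H) : LieAlg H := ⟨condExp S₀ X, condExp_mem X⟩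

/-- The one-parameter group `t ↦ e^{tX}`. -/
def expLie (X : LieAlg H) (t : ℝ) : UnitaryGroup H :=
  ⟨NormedSpace.exp (t • (X : H →L[ℂ] H)),
    let +nondep : NormedAlgebra ℚ (H →L[ℂ] H) := .restrictScalars ℚ ℂ _
    NormedSpace.exp_mem_unitary_of_mem_skewAdjoint (skewAdjoint.smul_mem t X.2)⟩

lemma isClosed_map (u : UnitaryGroup H) :
    IsClosed (S₀.toSubmodule.map ((u : H →L[ℂ] H) : H →ₗ[ℂ] H) : Set H) := by
  rw [← frame_zero_range]; exact isClosed_range_frame u 0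

/-- The point `u S₀`. -/
def grPoint (S₀ : ClosedSubmodule ℂ H) (u : UnitaryGroup H) : Gr S₀ :=
  ⟨⟨S₀.toSubmodule.map ((u : H →L[ℂ] H) : H →ₗ[ℂ] H), isClosed_map u⟩, u, rfl⟩

/-- The class `[(u, x)]` in `U(H) ×_{U(p)} S₀`, identified with the point `(u S₀, u x)` of the
tautological bundle. -/
def homPoint (u : UnitaryGroup H) (x : S₀.toSubmodule) : Tot S₀ :=
  ⟨grPoint S₀ u, ⟨(u : H →L[ℂ] H) x, Submodule.mem_map_of_mem x.2⟩⟩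

/-- The velocity at time `0` of a curve in the total space. -/
def velocity (γ : ℝ → Tot S₀) : TangentBundle (totModel S₀) (Tot S₀) :=
  tangentMap 𝓘(ℝ, ℝ) (totModel S₀) γ ⟨0, 1⟩

/-- The tangent vector `[((u, X), (x, y))]` of the tautological bundle: the velocity at `0` of the curve
`t ↦ [(u e^{tX}, x + t y)]`. -/
def homTangent (q : (UnitaryGroup H × LieAlg H) × (S₀.toSubmodule × S₀.toSubmodule)) :
    TangentBundle (totModel S₀) (Tot S₀) :=
  velocity fun t : ℝ => homPoint (q.1.1 * expLie q.1.2 t) (q.2.1 + t • q.2.2)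

/-- The universal connection on the tautological bundle,
`Φ [((u, X), (x, y))] = [((u, E_p X), (x, y))]`. Every tangent vector is of the form
`[((u, X), (x, y))]` (`homTangent_surjective`), and the right-hand side depends only on the class
(`universalConnection_homTangent`), so the default value `id` is never used. -/
def universalConnection (S₀ : ClosedSubmodule ℂ H) :
    TangentBundle (totModel S₀) (Tot S₀) → TangentBundle (totModel S₀) (Tot S₀) :=
  Function.extend homTangent
    (fun q => homTangent ((q.1.1, condExpLie S₀ q.1.2), q.2)) id

/-- The map `ε (x₁, x₂)` from the fiberwise sum of the bundle with itself to the vertical vectors: the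
velocity at `0` of the curve `t ↦ x₁ + t x₂` in the fiber over `S`. -/
def verticalLift (p : Σ S : Gr S₀, Fiber S × Fiber S) : TangentBundle (totModel S₀) (Tot S₀) :=
  velocity fun t : ℝ => ⟨p.1, p.2.1 + t • p.2.2⟩

/-- The map `r (ε (x₁, x₂)) = x₂` from vertical vectors to the bundle. It is well defined because `ε`
is injective (`verticalToFiber_verticalLift`); its values at vectors that are not vertical are
irrelevant. -/
def verticalToFiber (S₀ : ClosedSubmodule ℂ H) : TangentBundle (totModel S₀) (Tot S₀) → Tot S₀ :=
  Function.extend verticalLift (fun p => ⟨p.1, p.2.2⟩) (fun v => v.proj)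

/-- The covariant derivative `∇σ = r ∘ Φ ∘ Tσ` of a section `σ` for a connection `Φ`. -/
def covariantDerivative
    (Φ : TangentBundle (totModel S₀) (Tot S₀) → TangentBundle (totModel S₀) (Tot S₀))
    (σ : Gr S₀ → Tot S₀) : TangentBundle (grModel S₀) (Gr S₀) → Tot S₀ :=
  fun X => verticalToFiber S₀ (Φ (tangentMap (grModel S₀) (totModel S₀) σ X))

/-! ### The maps `Φ` and `r` are well defined -/

lemma contDiff_frame_apply (u : UnitaryGroup H) :
    ContDiff ℝ ∞ (fun q : Op S₀ × S₀.toSubmodule => frame u q.1 q.2) := by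
  have h0 : ContDiff ℂ ∞ (fun q : Op S₀ × S₀.toSubmodule => frame u q.1 q.2) :=
    ((contDiff_frame u).comp contDiff_fst).clm_apply contDiff_snd
  exact h0.restrict_scalars ℝ

lemma contMDiffAt_proj_tot (d₀ : Tot S₀) : ContMDiffAt (totModel S₀) (grModel S₀) ∞ (fun d : Tot S₀ => d.proj) d₀ := by
  exact Bundle.contMDiffAt_proj _

lemma contMDiffAt_fiberCoord (d₀ : Tot S₀) : ContMDiffAt (totModel S₀) 𝓘(ℝ, S₀.toSubmodule) ∞
    (fun d : Tot S₀ => pr S₀ (star (moveTo d₀.proj : H →L[ℂ] H) (d.2 : H))) d₀ := by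
  exact ((Bundle.contMDiffAt_totalSpace (IB := grModel S₀) (IM := totModel S₀) (n := ∞)
    (f := fun d : Tot S₀ => d) (x₀ := d₀)).mp contMDiffAt_id).2

lemma contMDiffAt_baseCoord (d₀ : Tot S₀) :  ContMDiffAt (totModel S₀) 𝓘(ℝ, Op S₀) ∞
      (fun d : Tot S₀ => chart (moveTo d₀.proj) d.proj) d₀ := by
  have hs : (chart (moveTo d₀.proj)).source ∈ 𝓝 d₀.proj :=
    (isOpen_chart_source _).mem_nhds (mem_chart_moveTo _)
  exact    ContMDiffAt.comp d₀ (g := chart (moveTo d₀.proj)) (f := fun d : Tot S₀ => d.proj)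
      ((contMDiffOn_chart (moveTo d₀.proj)).contMDiffAt hs) (contMDiffAt_proj_tot d₀)

lemma eventually_mem_source (d₀ : Tot S₀) : ∀ᶠ d in 𝓝 d₀, d.proj ∈ (chart (moveTo d₀.proj)).source := by
  have hs : (chart (moveTo d₀.proj)).source ∈ 𝓝 d₀.proj :=
    (isOpen_chart_source _).mem_nhds (mem_chart_moveTo _)
  exact (contMDiffAt_proj_tot d₀).continuousAt.eventually hs

lemma contMDiffAt_coord (d₀ : Tot S₀) : ContMDiffAt (totModel S₀) 𝓘(ℝ, Op S₀ × S₀.toSubmodule) ∞ (fun d : Tot S₀ =>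
      (chart (moveTo d₀.proj) d.proj,
        pr S₀ (star (moveTo d₀.proj : H →L[ℂ] H) (d.2 : H)))) d₀ := (contMDiffAt_baseCoord d₀).prodMk_space (contMDiffAt_fiberCoord d₀)

lemma contMDiffAt_comp_coord (d₀ : Tot S₀) (g : Op S₀ × S₀.toSubmodule → H) (hg : ContDiff ℝ ∞ g) : ContMDiffAt (totModel S₀) 𝓘(ℝ, H) ∞ (fun d : Tot S₀ =>
      g (chart (moveTo d₀.proj) d.proj,
        (pr S₀ (star (moveTo d₀.proj : H →L[ℂ] H) (d.2 : H))))) d₀ :=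
    ContMDiffAt.comp d₀ (I' := 𝓘(ℝ, Op S₀ × S₀.toSubmodule))
      (g := g) hg.contMDiff.contMDiffAt (contMDiffAt_coord d₀)
lemma contMDiff_ambient :
    ContMDiff (totModel S₀) 𝓘(ℝ, H) ∞ (fun d : Tot S₀ => (d.2 : H)) := by
  intro d₀
  refine (contMDiffAt_comp_coord d₀ _ (contDiff_frame_apply (moveTo d₀.proj))).congr_of_eventuallyEq ?_
  filter_upwards [eventually_mem_source d₀] with d hd
  exact (frame_pr hd d.2.2).symm

lemma chartPoint_zero (u : UnitaryGroup H) : chartPoint u 0 = grPoint S₀ u :=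
  Gr.ext (frame_zero_range u)

lemma transDen_self (u : UnitaryGroup H) (A : Op S₀) : transDen u u A = 1 := by
  ext x; rw [transDen_apply, pr_star_frame]; rfl

/-- Coordinates of a curve of points `w(t) S₀`. -/
lemma contDiff_transDen_curve (v : UnitaryGroup H) {w : ℝ → UnitaryGroup H}
    (hw : ContDiff ℝ ∞ (fun t => (w t : H →L[ℂ] H))) :
    ContDiff ℝ ∞ (fun t => transDen (S₀ := S₀) (w t) v 0) := by
  have h : ContDiff ℂ ∞ (fun T : H →L[ℂ] H =>
      pr S₀ ∘L star (v : H →L[ℂ] H) ∘L T ∘L graphMap S₀ 0) :=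
    contDiff_const.clm_comp (contDiff_const.clm_comp (contDiff_id.clm_comp contDiff_const))
  exact (h.restrict_scalars ℝ).comp hw

lemma contDiff_transNum_curve (v : UnitaryGroup H) {w : ℝ → UnitaryGroup H}
    (hw : ContDiff ℝ ∞ (fun t => (w t : H →L[ℂ] H))) :
    ContDiff ℝ ∞ (fun t => transNum (S₀ := S₀) (w t) v 0) := by
  have h : ContDiff ℂ ∞ (fun T : H →L[ℂ] H =>
      prPerp S₀ ∘L star (v : H →L[ℂ] H) ∘L T ∘L graphMap S₀ 0) :=
    contDiff_const.clm_comp (contDiff_const.clm_comp (contDiff_id.clm_comp contDiff_const))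
  exact (h.restrict_scalars ℝ).comp hw

lemma contDiffAt_chart_curve (v : UnitaryGroup H) {w : ℝ → UnitaryGroup H}
    (hw : ContDiff ℝ ∞ (fun t => (w t : H →L[ℂ] H))) {t₀ : ℝ}
    (h0 : IsUnit (transDen (S₀ := S₀) (w t₀) v 0)) :
    ContDiffAt ℝ ∞ (fun t => transNum (S₀ := S₀) (w t) v 0 ∘L
      Ring.inverse (transDen (S₀ := S₀) (w t) v 0)) t₀ := by
  obtain ⟨a, ha⟩ := h0
  have h1 : ContDiffAt ℝ ∞ (Ring.inverse : (S₀.toSubmodule →L[ℂ] S₀.toSubmodule) → _)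
      (transDen (S₀ := S₀) (w t₀) v 0) := by
    have h := contDiffAt_ringInverse ℂ (n := ∞) (R := S₀.toSubmodule →L[ℂ] S₀.toSubmodule) a
    rw [ha] at h
    exact h.restrict_scalars ℝ
  have h2 : ContDiffAt ℝ ∞ (fun t => Ring.inverse (transDen (S₀ := S₀) (w t) v 0)) t₀ :=
    ContDiffAt.comp t₀ (f := fun t => transDen (S₀ := S₀) (w t) v 0) h1
      (contDiff_transDen_curve v hw).contDiffAt
  have h3 : ContDiff ℂ ∞ (fun q : Op S₀ × (S₀.toSubmodule →L[ℂ] S₀.toSubmodule) => q.1 ∘L q.2) :=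
    contDiff_fst.clm_comp contDiff_snd
  exact (h3.restrict_scalars ℝ).contDiffAt.comp t₀
    ((contDiff_transNum_curve v hw).contDiffAt.prodMk h2)

lemma eventually_isUnit_curve (v : UnitaryGroup H) {w : ℝ → UnitaryGroup H}
    (hw : ContDiff ℝ ∞ (fun t => (w t : H →L[ℂ] H))) {t₀ : ℝ}
    (h0 : IsUnit (transDen (S₀ := S₀) (w t₀) v 0)) :
    ∀ᶠ t in 𝓝 t₀, IsUnit (transDen (S₀ := S₀) (w t) v 0) :=
  (contDiff_transDen_curve v hw).continuous.continuousAt.eventually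
    ((Units.isOpen (R := S₀.toSubmodule →L[ℂ] S₀.toSubmodule)).mem_nhds h0)

lemma contMDiff_grPoint {w : ℝ → UnitaryGroup H}
    (hw : ContDiff ℝ ∞ (fun t => (w t : H →L[ℂ] H))) :
    ContMDiff 𝓘(ℝ, ℝ) (grModel S₀) ∞ (fun t => grPoint S₀ (w t)) := by
  intro t₀
  have h0 : IsUnit (transDen (S₀ := S₀) (w t₀) (w t₀) 0) := by
    rw [transDen_self]; exact isUnit_one
  have h1 := (contMDiff_chartPoint (S₀ := S₀) (w t₀)).contMDiffAt.comp t₀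
    (contDiffAt_chart_curve (w t₀) hw h0).contMDiffAt
  refine h1.congr_of_eventuallyEq ?_
  filter_upwards [eventually_isUnit_curve (w t₀) hw h0] with t ht
  rw [Function.comp_apply, ← chartPoint_eq_of_isUnit _ _ _ ht, chartPoint_zero]

lemma contDiff_ambient_curve {w : ℝ → UnitaryGroup H} {c : ℝ → S₀.toSubmodule}
    (hw : ContDiff ℝ ∞ (fun t => (w t : H →L[ℂ] H))) (hc : ContDiff ℝ ∞ c) :
    ContDiff ℝ ∞ (fun t => (w t : H →L[ℂ] H) (c t)) := by
  have h : ContDiff ℂ ∞ (fun q : (H →L[ℂ] H) × S₀.toSubmodule => q.1 (q.2 : H)) :=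
    contDiff_fst.clm_apply (S₀.toSubmodule.subtypeL.contDiff.comp contDiff_snd)
  exact (h.restrict_scalars ℝ).comp (hw.prodMk hc)

lemma contMDiff_homPoint {w : ℝ → UnitaryGroup H} {c : ℝ → S₀.toSubmodule}
    (hw : ContDiff ℝ ∞ (fun t => (w t : H →L[ℂ] H))) (hc : ContDiff ℝ ∞ c) :
    ContMDiff 𝓘(ℝ, ℝ) (totModel S₀) ∞ (fun t => homPoint (w t) (c t)) := by
  intro t₀
  rw [Bundle.contMDiffAt_totalSpace]
  refine ⟨contMDiff_grPoint hw t₀, ?_⟩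
  change ContMDiffAt 𝓘(ℝ, ℝ) 𝓘(ℝ, S₀.toSubmodule) ∞
    (fun t => pr S₀ (star (moveTo (grPoint S₀ (w t₀)) : H →L[ℂ] H) ((w t : H →L[ℂ] H) (c t)))) t₀
  have h : ContDiff ℂ ∞ (fun z : H =>
      pr S₀ (star (moveTo (grPoint S₀ (w t₀)) : H →L[ℂ] H) z)) :=
    (pr S₀ ∘L star (moveTo (grPoint S₀ (w t₀)) : H →L[ℂ] H)).contDiff
  exact ((h.restrict_scalars ℝ).comp (contDiff_ambient_curve hw hc)).contDiffAt.contMDiffAt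

lemma contDiff_expLie (u : UnitaryGroup H) (X : LieAlg H) :
    ContDiff ℝ ∞ (fun t : ℝ => ((u * expLie X t : UnitaryGroup H) : H →L[ℂ] H)) := by
  have h1 : ContDiff ℝ ∞ (NormedSpace.exp : (H →L[ℂ] H) → H →L[ℂ] H) := by
    rw [contDiff_iff_contDiffAt]
    intro Y
    exact (NormedSpace.exp_analytic (𝕂 := ℝ) Y).contDiffAt
  have h2 : ContDiff ℝ ∞ (fun t : ℝ => t • (X : H →L[ℂ] H)) := contDiff_id.smul contDiff_const
  exact (contDiff_const (c := (u : H →L[ℂ] H))).mul (h1.comp h2)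

lemma expLie_zero (X : LieAlg H) : expLie X 0 = 1 := by
  let +nondep : NormedAlgebra ℚ (H →L[ℂ] H) := .restrictScalars ℚ ℂ _
  apply Subtype.ext
  change NormedSpace.exp ((0 : ℝ) • (X : H →L[ℂ] H)) = 1
  rw [zero_smul, NormedSpace.exp_zero]

lemma hasDerivAt_expLie (u : UnitaryGroup H) (X : LieAlg H) (x y : S₀.toSubmodule) :
    HasDerivAt (fun t : ℝ => ((u * expLie X t : UnitaryGroup H) : H →L[ℂ] H)
        ((x + t • y : S₀.toSubmodule) : H))
      ((u : H →L[ℂ] H) ((X : H →L[ℂ] H) x + y)) 0 := by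
  have h1 : HasDerivAt (fun t : ℝ => (expLie X t : H →L[ℂ] H)) (X : H →L[ℂ] H) 0 := by
    have h := hasDerivAt_exp_smul_const (𝕂 := ℝ) (X : H →L[ℂ] H) (0 : ℝ)
    have e : NormedSpace.exp ((0 : ℝ) • (X : H →L[ℂ] H)) = 1 := congrArg Subtype.val (expLie_zero X)
    rw [e, one_mul] at h
    exact h
  have h2 : HasDerivAt (fun t : ℝ => ((x + t • y : S₀.toSubmodule) : H)) (y : H) 0 := by
    have h := ((hasDerivAt_id (0 : ℝ)).smul_const (y : H)).const_add (x : H)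
    rw [one_smul] at h
    exact h
  have h3 : HasDerivAt (fun t : ℝ => (expLie X t : H →L[ℂ] H) ((x + t • y : S₀.toSubmodule) : H))
      ((X : H →L[ℂ] H) x + y) 0 := by
    have hb : IsBoundedBilinearMap ℝ (fun q : (H →L[ℂ] H) × H => q.1 q.2) :=
      { add_left := fun _ _ _ => rfl
        smul_left := fun _ _ _ => rfl
        add_right := fun T _ _ => map_add T _ _
        smul_right := fun c T z => T.map_smul_of_tower c z
        bound := ⟨1, one_pos, fun T z => by rw [one_mul]; exact T.le_opNorm z⟩ }
    have h := (hb.hasFDerivAt ((expLie X 0 : H →L[ℂ] H), ((x + (0 : ℝ) • y : S₀.toSubmodule) : H))).comp_hasDerivAt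
      (0 : ℝ) (h1.prodMk h2)
    refine h.congr_deriv ?_
    rw [IsBoundedBilinearMap.deriv_apply, expLie_zero]
    simp [add_comm]
  have hu : HasFDerivAt (fun z : H => (u : H →L[ℂ] H) z)
      ((u : H →L[ℂ] H).restrictScalars ℝ) ((expLie X 0 : H →L[ℂ] H) ((x + (0 : ℝ) • y : S₀.toSubmodule) : H)) :=
    ((u : H →L[ℂ] H).restrictScalars ℝ).hasFDerivAt
  exact hu.comp_hasDerivAt (0 : ℝ) h3

/-- Image of a velocity under the differential of `(S, x) ↦ x`. -/
lemma mfderiv_ambient_velocity {γ : ℝ → Tot S₀}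
    (hγ : MDifferentiableAt 𝓘(ℝ, ℝ) (totModel S₀) γ 0) {z : H}
    (hz : HasDerivAt (fun t => ((γ t).2 : H)) z 0) :
    tangentMap (totModel S₀) 𝓘(ℝ, H) (fun d : Tot S₀ => (d.2 : H)) (velocity γ)
      = ⟨((γ 0).2 : H), z⟩ := by
  have h1 : MDifferentiableAt (totModel S₀) 𝓘(ℝ, H) (fun d : Tot S₀ => (d.2 : H)) (γ 0) :=
    contMDiff_ambient.mdifferentiableAt (by simp)
  have h2 := tangentMap_comp_at (p := (⟨0, 1⟩ : TangentBundle 𝓘(ℝ, ℝ) ℝ)) h1 hγ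
  rw [velocity, ← h2]
  have h3 : mfderiv 𝓘(ℝ, ℝ) 𝓘(ℝ, H) (fun t => ((γ t).2 : H)) 0 (1 : ℝ) = z := by
    rw [mfderiv_eq_fderiv]
    exact hz.deriv
  exact congrArg (fun w : H => (⟨((γ 0).2 : H), w⟩ : TangentBundle 𝓘(ℝ, H) H)) h3

lemma tot_ext {d d' : Tot S₀} (h1 : d.proj = d'.proj) (h2 : (d.2 : H) = d'.2) : d = d' := by
  obtain ⟨S, x⟩ := d
  obtain ⟨S', x'⟩ := d'
  obtain rfl : S = S' := h1
  obtain rfl : x = x' := Subtype.ext h2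
  rfl

/-- The inclusion of a fiber into the total space. -/
def fiberIncl (S : Gr S₀) (x : Fiber S) : Tot S₀ := ⟨S, x⟩

lemma contMDiff_fiberIncl (S : Gr S₀) :
    ContMDiff 𝓘(ℝ, Fiber S) (totModel S₀) ∞ (fiberIncl S) := by
  intro x₀
  rw [Bundle.contMDiffAt_totalSpace]
  refine ⟨contMDiffAt_const, ?_⟩
  have h : ContDiff ℂ ∞ (fun x : Fiber S => pr S₀ (star (moveTo S : H →L[ℂ] H) (x : H))) :=
    (pr S₀ ∘L star (moveTo S : H →L[ℂ] H) ∘L S.space.toSubmodule.subtypeL).contDiff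
  exact (h.restrict_scalars ℝ).contDiffAt.contMDiffAt

lemma velocity_fiberIncl {S : Gr S₀} {c : ℝ → Fiber S} {c' : Fiber S} (hc : HasDerivAt c c' 0) :
    velocity (fun t => fiberIncl S (c t))
      = tangentMap 𝓘(ℝ, Fiber S) (totModel S₀) (fiberIncl S) ⟨c 0, c'⟩ := by
  have h1 : MDifferentiableAt 𝓘(ℝ, Fiber S) (totModel S₀) (fiberIncl S) (c 0) :=
    (contMDiff_fiberIncl S).mdifferentiableAt (by simp)
  have h0 : MDifferentiableAt 𝓘(ℝ, ℝ) 𝓘(ℝ, Fiber S) c 0 :=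
    hc.differentiableAt.mdifferentiableAt
  have h2 := tangentMap_comp_at (p := (⟨0, 1⟩ : TangentBundle 𝓘(ℝ, ℝ) ℝ)) h1 h0
  have h3 : mfderiv 𝓘(ℝ, ℝ) 𝓘(ℝ, Fiber S) c 0 (1 : ℝ) = c' := by
    rw [mfderiv_eq_fderiv]
    exact hc.deriv
  refine h2.trans ?_
  exact congrArg (fun w : Fiber S => tangentMap 𝓘(ℝ, Fiber S) (totModel S₀) (fiberIncl S)
    ⟨c 0, w⟩) h3

lemma hasDerivAt_line {E : Type*} [NormedAddCommGroup E] [NormedSpace ℝ E] (x y : E) :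
    HasDerivAt (fun t : ℝ => x + t • y) y 0 := by
  have h := ((hasDerivAt_id (0 : ℝ)).smul_const y).const_add x
  rw [one_smul] at h
  exact h

lemma verticalLift_eq (S : Gr S₀) (x₁ x₂ : Fiber S) :
    verticalLift ⟨S, x₁, x₂⟩
      = tangentMap 𝓘(ℝ, Fiber S) (totModel S₀) (fiberIncl S) ⟨x₁, x₂⟩ := by
  have h := velocity_fiberIncl (hasDerivAt_line x₁ x₂)
  rw [zero_smul, add_zero] at h
  exact h

lemma mDifferentiableAt_line (S : Gr S₀) (x₁ x₂ : Fiber S) :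
    MDifferentiableAt 𝓘(ℝ, ℝ) (totModel S₀) (fun t : ℝ => fiberIncl S (x₁ + t • x₂)) 0 :=
  ((contMDiff_fiberIncl S).mdifferentiableAt (by simp)).comp (0 : ℝ)
    (hasDerivAt_line x₁ x₂).differentiableAt.mdifferentiableAt

lemma tangentMap_ambient_verticalLift (S : Gr S₀) (x₁ x₂ : Fiber S) :
    tangentMap (totModel S₀) 𝓘(ℝ, H) (fun d : Tot S₀ => (d.2 : H)) (verticalLift ⟨S, x₁, x₂⟩)
      = ⟨(x₁ : H), (x₂ : H)⟩ := by
  have h := mfderiv_ambient_velocity (mDifferentiableAt_line S x₁ x₂) (z := (x₂ : H))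
    (hasDerivAt_line (x₁ : H) (x₂ : H))
  refine h.trans ?_
  congr 1
  change ((x₁ + (0 : ℝ) • x₂ : Fiber S) : H) = x₁
  rw [zero_smul, add_zero]

lemma verticalLift_injective :
    Function.Injective (verticalLift : (Σ S : Gr S₀, Fiber S × Fiber S) → _) := by
  rintro ⟨S, x₁, x₂⟩ ⟨T, y₁, y₂⟩ h
  have hb := congrArg (fun v : TangentBundle (totModel S₀) (Tot S₀) => v.proj) h
  have hb1 : S = T := congrArg (fun d : Tot S₀ => d.proj) hb
  subst hb1
  have hJ := congrArg (tangentMap (totModel S₀) 𝓘(ℝ, H) (fun d : Tot S₀ => (d.2 : H))) h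
  rw [tangentMap_ambient_verticalLift, tangentMap_ambient_verticalLift] at hJ
  have e1 : (x₁ : H) = y₁ := congrArg (fun v : TangentBundle 𝓘(ℝ, H) H => v.proj) hJ
  have e2 : (x₂ : H) = y₂ := congrArg (fun v : TangentBundle 𝓘(ℝ, H) H => (v.2 : H)) hJ
  rw [Subtype.ext e1, Subtype.ext e2]

/-- `r` is well defined on vertical vectors. -/
theorem verticalToFiber_verticalLift (p : Σ S : Gr S₀, Fiber S × Fiber S) :
    verticalToFiber S₀ (verticalLift p) = ⟨p.1, p.2.2⟩ :=
  verticalLift_injective.extend_apply _ _ _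

lemma map_eq_of_commute {T : (H →L[ℂ] H)ˣ}
    (hT : Commute (T : H →L[ℂ] H) S₀.toSubmodule.starProjection) :
    S₀.toSubmodule.map ((T : H →L[ℂ] H) : H →ₗ[ℂ] H) = S₀.toSubmodule := by
  apply le_antisymm
  · rintro _ ⟨x, hx, rfl⟩
    exact mem_of_commute hT hx
  · intro x hx
    refine ⟨(↑T⁻¹ : H →L[ℂ] H) x, mem_of_commute hT.units_inv_left hx, ?_⟩
    exact congrArg (fun A : H →L[ℂ] H => A x) T.mul_inv

lemma grPoint_mul_of_commute (u w : UnitaryGroup H)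
    (hw : Commute (w : H →L[ℂ] H) S₀.toSubmodule.starProjection) :
    grPoint S₀ (u * w) = grPoint S₀ u := by
  apply Gr.ext
  have h := map_eq_of_commute (T := Unitary.toUnits w) hw
  change S₀.toSubmodule.map ((u * w : H →L[ℂ] H) : H →ₗ[ℂ] H)
    = S₀.toSubmodule.map ((u : H →L[ℂ] H) : H →ₗ[ℂ] H)
  conv_rhs => rw [← h]
  rw [← Submodule.map_comp]
  rfl

lemma commute_expLie {X : LieAlg H}
    (hX : Commute (X : H →L[ℂ] H) S₀.toSubmodule.starProjection) (t : ℝ) :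
    Commute (expLie X t : H →L[ℂ] H) S₀.toSubmodule.starProjection := by
  let +nondep : NormedAlgebra ℚ (H →L[ℂ] H) := .restrictScalars ℚ ℂ _
  exact ((hX.symm.smul_right t).exp_right).symm

/-- The vector `u x` in the fiber over `u S₀`. -/
def homVec (u : UnitaryGroup H) (x : S₀.toSubmodule) : Fiber (grPoint S₀ u) :=
  ⟨(u : H →L[ℂ] H) x, Submodule.mem_map_of_mem x.2⟩

lemma homTangent_of_commute (u : UnitaryGroup H) (X : LieAlg H) (x y : S₀.toSubmodule)
    (hX : Commute (X : H →L[ℂ] H) S₀.toSubmodule.starProjection) :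
    homTangent ((u, X), (x, y)) = verticalLift ⟨grPoint S₀ u, homVec u x,
      (grPoint S₀ u).space.toSubmodule.orthogonalProjectionOnto
        ((u : H →L[ℂ] H) ((X : H →L[ℂ] H) x + y))⟩ := by
  set Q : H →L[ℂ] Fiber (grPoint S₀ u) :=
    (grPoint S₀ u).space.toSubmodule.orthogonalProjectionOnto with hQ
  have hg : ∀ t, grPoint S₀ (u * expLie X t) = grPoint S₀ u := fun t =>
    grPoint_mul_of_commute u _ (commute_expLie hX t)
  have hmem : ∀ (t : ℝ) (z : S₀.toSubmodule),
      ((u * expLie X t : UnitaryGroup H) : H →L[ℂ] H) z ∈ (grPoint S₀ u).space.toSubmodule := by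
    intro t z
    rw [← hg t]
    exact (homPoint (u * expLie X t) z).2.2
  have hc : HasDerivAt (fun t : ℝ => Q (((u * expLie X t : UnitaryGroup H) : H →L[ℂ] H)
      ((x + t • y : S₀.toSubmodule) : H))) (Q ((u : H →L[ℂ] H) ((X : H →L[ℂ] H) x + y))) 0 := by
    have hu : HasFDerivAt (fun z : H => Q z) (Q.restrictScalars ℝ)
        (((u * expLie X 0 : UnitaryGroup H) : H →L[ℂ] H)
          ((x + (0 : ℝ) • y : S₀.toSubmodule) : H)) := (Q.restrictScalars ℝ).hasFDerivAt
    exact hu.comp_hasDerivAt (0 : ℝ) (hasDerivAt_expLie u X x y)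
  have h1 := velocity_fiberIncl hc
  have hpt : ∀ t : ℝ, fiberIncl (grPoint S₀ u) (Q (((u * expLie X t : UnitaryGroup H) : H →L[ℂ] H)
      ((x + t • y : S₀.toSubmodule) : H))) = homPoint (u * expLie X t) (x + t • y) := fun t =>
    tot_ext (hg t).symm (congrArg Subtype.val
      (Submodule.orthogonalProjectionOnto_mem_subspace_eq_self ⟨_, hmem t (x + t • y)⟩))
  have hfun := funext hpt
  rw [hfun, expLie_zero, mul_one, zero_smul, add_zero] at h1
  rw [verticalLift_eq]
  have e : Q ((u : H →L[ℂ] H) (x : H)) = homVec u x :=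
    Submodule.orthogonalProjectionOnto_mem_subspace_eq_self (homVec u x)
  rw [e] at h1
  exact h1

lemma commute_condExp (X : LieAlg H) :
    Commute (condExpLie S₀ X : H →L[ℂ] H) S₀.toSubmodule.starProjection := by
  have hP : S₀.toSubmodule.starProjection * S₀.toSubmodule.starProjection
    = S₀.toSubmodule.starProjection := Submodule.isIdempotentElem_starProjection _
  change condExp S₀ X * _ = _ * condExp S₀ X
  rw [condExp]
  generalize S₀.toSubmodule.starProjection = P at hP
  simp only [add_mul, mul_add, sub_mul, mul_sub, mul_one, one_mul, mul_assoc, hP]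
  simp only [← mul_assoc, hP]
  simp

lemma condExp_coe (X : LieAlg H) (x : S₀.toSubmodule) :
    (condExpLie S₀ X : H →L[ℂ] H) x = (pr S₀ ((X : H →L[ℂ] H) x) : H) := by
  have hP : S₀.toSubmodule.starProjection (x : H) = x :=
    Submodule.starProjection_eq_self_iff.mpr x.2
  change S₀.toSubmodule.starProjection ((X : H →L[ℂ] H) (S₀.toSubmodule.starProjection x))
    + (1 - S₀.toSubmodule.starProjection)
      ((X : H →L[ℂ] H) ((x : H) - S₀.toSubmodule.starProjection x)) = _
  rw [hP, sub_self, map_zero, map_zero, add_zero]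
  rfl

lemma proj_condExp (u : UnitaryGroup H) (X : LieAlg H) (x y : S₀.toSubmodule) :
    (grPoint S₀ u).space.toSubmodule.orthogonalProjectionOnto
        ((u : H →L[ℂ] H) ((condExpLie S₀ X : H →L[ℂ] H) x + y))
      = (grPoint S₀ u).space.toSubmodule.orthogonalProjectionOnto
        ((u : H →L[ℂ] H) ((X : H →L[ℂ] H) x + y)) := by
  rw [condExp_coe, ← sub_eq_zero, ← map_sub, ← map_sub]
  rw [Submodule.orthogonalProjectionOnto_eq_zero_iff]
  have e : (pr S₀ ((X : H →L[ℂ] H) x) : H) + (y : H) - ((X : H →L[ℂ] H) x + (y : H))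
      = - (prPerp S₀ ((X : H →L[ℂ] H) x) : H) := by
    conv_lhs => rw [← pr_add_prPerp (S₀ := S₀) ((X : H →L[ℂ] H) x)]
    simp
  rw [e, map_neg]
  apply neg_mem
  rintro _ ⟨z, hz, rfl⟩
  change inner ℂ ((u : H →L[ℂ] H) z) _ = 0
  have hin : ∀ a b : H, inner ℂ ((u : H →L[ℂ] H) a) ((u : H →L[ℂ] H) b) = inner ℂ a b := fun a b =>
    (Unitary.linearIsometryEquiv u).inner_map_map a b
  rw [hin]
  exact Submodule.inner_right_of_mem_orthogonal hz (prPerp S₀ _).2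

/-- The point and the ambient derivative underlying a tangent vector. -/
lemma tangentMap_ambient_homTangent (u : UnitaryGroup H) (X : LieAlg H) (x y : S₀.toSubmodule) :
    tangentMap (totModel S₀) 𝓘(ℝ, H) (fun d : Tot S₀ => (d.2 : H)) (homTangent ((u, X), (x, y)))
      = ⟨(u : H →L[ℂ] H) x, (u : H →L[ℂ] H) ((X : H →L[ℂ] H) x + y)⟩ := by
  have hd : MDifferentiableAt 𝓘(ℝ, ℝ) (totModel S₀)
      (fun t : ℝ => homPoint (u * expLie X t) (x + t • y)) 0 :=
    (contMDiff_homPoint (contDiff_expLie u X)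
      (contDiff_const.add (contDiff_id.smul contDiff_const))).mdifferentiableAt (by simp)
  refine (mfderiv_ambient_velocity hd (hasDerivAt_expLie u X x y)).trans ?_
  congr 1
  change ((u * expLie X 0 : UnitaryGroup H) : H →L[ℂ] H) ((x + (0 : ℝ) • y : S₀.toSubmodule) : H) = _
  rw [expLie_zero, mul_one, zero_smul, add_zero]

lemma proj_homTangent (u : UnitaryGroup H) (X : LieAlg H) (x y : S₀.toSubmodule) :
    (homTangent ((u, X), (x, y))).proj = homPoint u x := by
  change homPoint (u * expLie X 0) (x + (0 : ℝ) • y) = _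
  rw [expLie_zero, mul_one, zero_smul, add_zero]

lemma homTangent_condExp (u : UnitaryGroup H) (X : LieAlg H) (x y : S₀.toSubmodule) :
    homTangent ((u, condExpLie S₀ X), (x, y)) = verticalLift ⟨(homPoint u x).proj, (homPoint u x).2,
      (homPoint u x).proj.space.toSubmodule.orthogonalProjectionOnto
        ((u : H →L[ℂ] H) ((X : H →L[ℂ] H) x + y))⟩ := by
  rw [homTangent_of_commute u _ x y (commute_condExp X), proj_condExp]
  rfl

/-- `Φ` is well defined on classes. -/
theorem universalConnection_homTangent (u : UnitaryGroup H) (X : LieAlg H) (x y : S₀.toSubmodule) :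
    universalConnection S₀ (homTangent ((u, X), (x, y)))
      = homTangent ((u, condExpLie S₀ X), (x, y)) := by
  refine Function.FactorsThrough.extend_apply (f := homTangent)
    (g := fun q => homTangent ((q.1.1, condExpLie S₀ q.1.2), q.2)) ?_ id ((u, X), (x, y))
  rintro ⟨⟨u, X⟩, ⟨x, y⟩⟩ ⟨⟨u', X'⟩, ⟨x', y'⟩⟩ h
  dsimp only
  have hb := congrArg (fun v : TangentBundle (totModel S₀) (Tot S₀) => v.proj) h
  rw [proj_homTangent, proj_homTangent] at hb
  have hJ := congrArg (tangentMap (totModel S₀) 𝓘(ℝ, H) (fun d : Tot S₀ => (d.2 : H))) h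
  rw [tangentMap_ambient_homTangent, tangentMap_ambient_homTangent] at hJ
  have e2 : (u : H →L[ℂ] H) ((X : H →L[ℂ] H) x + y) = (u' : H →L[ℂ] H) ((X' : H →L[ℂ] H) x' + y') :=
    congrArg (fun v : TangentBundle 𝓘(ℝ, H) H => (v.2 : H)) hJ
  rw [homTangent_condExp, homTangent_condExp, hb, e2]

lemma extChartAt_tot (d d' : Tot S₀) :
    extChartAt (totModel S₀) d d' = (chart (moveTo d.proj) d'.proj,
      pr S₀ (star (moveTo d.proj : H →L[ℂ] H) (d'.2 : H))) := by
  rfl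

/-- `f` has derivative `e` at `0`. -/
abbrev HasVel {E : Type*} [NormedAddCommGroup E] [NormedSpace ℝ E] (f : ℝ → E) (e : E) : Prop :=
  HasDerivAt f e 0

lemma tangentMap_eq_of_hasVel {E F Q M : Type*} [NormedAddCommGroup E] [NormedSpace ℝ E]
    [NormedAddCommGroup F] [NormedSpace ℝ F]
    [TopologicalSpace Q] {I : ModelWithCorners ℝ (E × F) Q} [TopologicalSpace M] [ChartedSpace Q M]
    {γ : ℝ → M} {d : M} (hd : γ 0 = d) (hγ : ContinuousAt γ 0) {A : E} {y : F}
    {f : ℝ → E} {g : ℝ → F} (hA : HasVel f A) (hy : HasVel g y)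
    (hfg : ∀ t, extChartAt I d (γ t) = (f t, g t)) :
    tangentMap 𝓘(ℝ, ℝ) I γ ⟨0, 1⟩ = ⟨d, (A, y)⟩ := by
  subst hd
  have hF : HasFDerivAt (fun t => extChartAt I (γ 0) (γ t))
      ((ContinuousLinearMap.toSpanSingleton ℝ A).prod (ContinuousLinearMap.toSpanSingleton ℝ y))
      (0 : ℝ) := by
    simp only [hfg]
    exact hA.hasFDerivAt.prodMk hy.hasFDerivAt
  have h : HasMFDerivAt 𝓘(ℝ, ℝ) I γ 0
     ((ContinuousLinearMap.toSpanSingleton ℝ A).prod (ContinuousLinearMap.toSpanSingleton ℝ y)) :=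
    ⟨hγ, hF.hasFDerivWithinAt⟩
  have h2 : mfderiv 𝓘(ℝ, ℝ) I γ 0 (1 : ℝ) = (A, y) := by
    rw [h.mfderiv]
    exact Prod.ext (one_smul ℝ A) (one_smul ℝ y)
  exact congrArg (fun w : E × F => (⟨γ 0, w⟩ : TangentBundle I M)) h2

/-- `b` is a bounded bilinear map over the reals. -/
abbrev IsRealBilinear {E F G : Type*} [NormedAddCommGroup E] [NormedSpace ℝ E]
    [NormedAddCommGroup F] [NormedSpace ℝ F] [NormedAddCommGroup G] [NormedSpace ℝ G]
    (b : E × F → G) : Prop := IsBoundedBilinearMap ℝ b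

lemma hasVel_bilinear {E F G : Type*} [NormedAddCommGroup E] [NormedSpace ℝ E]
    [NormedAddCommGroup F] [NormedSpace ℝ F] [NormedAddCommGroup G] [NormedSpace ℝ G]
    {b : E × F → G} (hb : IsRealBilinear b) {f : ℝ → E} {g : ℝ → F} {e : E}
    (hf : HasVel f e) (hg : ContDiffAt ℝ ∞ g 0) (h0 : f 0 = 0) :
    HasVel (fun t => b (f t, g t)) (b (e, g 0)) := by
  have hg' : HasDerivAt g (deriv g 0) 0 := (hg.differentiableAt (by simp)).hasDerivAt
  have h := (hb.hasFDerivAt (f 0, g 0)).comp_hasDerivAt (0 : ℝ) (hf.prodMk hg')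
  refine h.congr_deriv ?_
  rw [IsBoundedBilinearMap.deriv_apply, h0]
  have : b (0, deriv g 0) = 0 := by
    have := hb.smul_left (0 : ℝ) (0 : E) (deriv g 0)
    simpa using this
  simp [this]

lemma hasVel_clm {E F : Type*} [NormedAddCommGroup E] [NormedSpace ℂ E] [NormedAddCommGroup F]
    [NormedSpace ℂ F] [NormedSpace ℝ E] [NormedSpace ℝ F] [IsScalarTower ℝ ℂ E]
    [IsScalarTower ℝ ℂ F] (L : E →L[ℂ] F) {f : ℝ → E} {e : E}
    (hf : HasVel f e) : HasVel (fun t => L (f t)) (L e) :=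
  HasFDerivAt.comp_hasDerivAt (0 : ℝ) (f := f) (l := fun z => L z) (l' := L.restrictScalars ℝ)
    (L.restrictScalars ℝ).hasFDerivAt hf

lemma hasVel_exp (X : LieAlg H) :
    HasVel (fun t : ℝ => (expLie X t : H →L[ℂ] H)) (X : H →L[ℂ] H) := by
  have h := hasDerivAt_exp_smul_const (𝕂 := ℝ) (X : H →L[ℂ] H) (0 : ℝ)
  have e : NormedSpace.exp ((0 : ℝ) • (X : H →L[ℂ] H)) = 1 := congrArg Subtype.val (expLie_zero X)
  rw [e, one_mul] at h
  exact h

lemma isBoundedBilinearMap_comp_real : IsRealBilinear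
      (fun q : Op S₀ × (S₀.toSubmodule →L[ℂ] S₀.toSubmodule) => q.1 ∘L q.2) :=
    { add_left := fun _ _ _ => rfl
      smul_left := fun _ _ _ => rfl
      add_right := fun T _ _ => ContinuousLinearMap.comp_add T _ _
      smul_right := fun c T z => by
        ext a; exact congrArg Subtype.val (T.map_smul_of_tower c (z a))
      bound := ⟨1, one_pos, fun T z => by rw [one_mul]; exact T.opNorm_comp_le z⟩ }

lemma hasVel_sandwich {E F G K : Type*} [NormedAddCommGroup E] [NormedSpace ℂ E]
    [NormedAddCommGroup F] [NormedSpace ℂ F] [NormedAddCommGroup G] [NormedSpace ℂ G]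
    [NormedAddCommGroup K] [NormedSpace ℂ K] (P : F →L[ℂ] G) (Q : E →L[ℂ] K)
    {T : ℝ → K →L[ℂ] F} {T' : K →L[ℂ] F} (h : HasVel T T') :
    HasVel (fun t => P ∘L T t ∘L Q) (P ∘L T' ∘L Q) :=
  hasVel_clm ((ContinuousLinearMap.compL ℂ E F G P) ∘L
    ((ContinuousLinearMap.compL ℂ E K F).flip Q)) h

/-- Off-diagonal block of an operator. -/
def block (S₀ : ClosedSubmodule ℂ H) (T : H →L[ℂ] H) : Op S₀ :=
  prPerp S₀ ∘L T ∘L S₀.toSubmodule.subtypeL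

lemma block_apply (T : H →L[ℂ] H) (x : S₀.toSubmodule) : block S₀ T x = prPerp S₀ (T x) := rfl

lemma transNum_exp (v : UnitaryGroup H) (X : LieAlg H) (t : ℝ) :
    transNum (S₀ := S₀) (v * expLie X t) v 0 = block S₀ (expLie X t : H →L[ℂ] H) := by
  ext x
  rw [transNum_apply, frame_apply, block_apply]
  have : ((v * expLie X t : UnitaryGroup H) : H →L[ℂ] H) (graphMap S₀ 0 x)
      = (v : H →L[ℂ] H) ((expLie X t : H →L[ℂ] H) x) := by
    simp [graphMap_apply]
  rw [this, star_coe_apply]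

lemma hasVel_block (X : LieAlg H) :
    HasVel (fun t => block S₀ (expLie X t : H →L[ℂ] H)) (block S₀ (X : H →L[ℂ] H)) :=
  hasVel_sandwich (prPerp S₀) S₀.toSubmodule.subtypeL (hasVel_exp X)

lemma contDiffAt_inverse_transDen (v : UnitaryGroup H) {w : ℝ → UnitaryGroup H}
    (hw : ContDiff ℝ ∞ (fun t => (w t : H →L[ℂ] H))) {t₀ : ℝ}
    (h0 : IsUnit (transDen (S₀ := S₀) (w t₀) v 0)) :
    ContDiffAt ℝ ∞ (fun t => Ring.inverse (transDen (S₀ := S₀) (w t) v 0)) t₀ := by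
  obtain ⟨a, ha⟩ := h0
  have h1 : ContDiffAt ℝ ∞ (Ring.inverse : (S₀.toSubmodule →L[ℂ] S₀.toSubmodule) → _)
      (transDen (S₀ := S₀) (w t₀) v 0) := by
    have h := contDiffAt_ringInverse ℂ (n := ∞) (R := S₀.toSubmodule →L[ℂ] S₀.toSubmodule) a
    rw [ha] at h
    exact h.restrict_scalars ℝ
  exact ContDiffAt.comp t₀ (f := fun t => transDen (S₀ := S₀) (w t) v 0) h1
      (contDiff_transDen_curve v hw).contDiffAt

lemma hasVel_chart_curve (v : UnitaryGroup H) (X : LieAlg H) :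
    HasVel (fun t : ℝ => chart v (grPoint S₀ (v * expLie X t))) (block S₀ (X : H →L[ℂ] H)) := by
  have hw := contDiff_expLie v X
  have hD0 : transDen (S₀ := S₀) (v * expLie X 0) v 0 = 1 := by
    rw [expLie_zero, mul_one, transDen_self]
  have hU : IsUnit (transDen (S₀ := S₀) (v * expLie X 0) v 0) := by rw [hD0]; exact isUnit_one
  have hN := hasVel_block (S₀ := S₀) X
  have hN0 : block S₀ (expLie X 0 : H →L[ℂ] H) = 0 := by
    rw [expLie_zero]; ext x; rw [block_apply]; simp
  have h := hasVel_bilinear isBoundedBilinearMap_comp_real hN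
    (contDiffAt_inverse_transDen v hw hU) hN0
  have e : block S₀ (X : H →L[ℂ] H) ∘L Ring.inverse (transDen (S₀ := S₀) (v * expLie X 0) v 0)
      = block S₀ (X : H →L[ℂ] H) := by
    rw [hD0, Ring.inverse_one]; ext x; rfl
  dsimp only at h
  rw [e] at h
  refine h.congr_of_eventuallyEq ?_
  filter_upwards [eventually_isUnit_curve v hw hU] with t ht
  rw [← chartPoint_zero, chart_trans_apply _ _ _ ht, transNum_exp]

lemma chart_moveTo_self (S : Gr S₀) : chart (moveTo S) S = 0 := by
  have h2 := chartPoint_chart (moveTo S) (mem_chart_moveTo S)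
  exact chartPoint_injective (moveTo S) (h2.trans (chartPoint_moveTo S).symm)

/-- Every tangent vector of the tautological bundle is of the form `[((u, X), (x, y))]`. -/
theorem homTangent_surjective : Function.Surjective (homTangent (S₀ := S₀)) := by
  rintro ⟨⟨S, s⟩, ζ⟩
  obtain ⟨A, y⟩ : Op S₀ × S₀.toSubmodule := ζ
  set v := moveTo S with hv
  set x := pr S₀ (star (v : H →L[ℂ] H) (s : H)) with hx
  let X : LieAlg H := ⟨skewBlock A, star_skewBlock A⟩
  have hS : grPoint S₀ v = S := by rw [← chartPoint_zero]; exact chartPoint_moveTo S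
  have hs : (v : H →L[ℂ] H) x = s := by
    have h1 := frame_pr (mem_chart_moveTo S) s.2
    rw [chart_moveTo_self] at h1
    rw [← h1]
    simp [frame, graphMap, hx, hv]
  have hd : homPoint (v * expLie X 0) (x + (0 : ℝ) • y) = (⟨S, s⟩ : Tot S₀) := by
    rw [expLie_zero, mul_one, zero_smul, add_zero]
    exact tot_ext hS hs
  refine ⟨((v, X), (x, y)), ?_⟩
  have hc : ContDiff ℝ ∞ (fun t : ℝ => x + t • y) :=
    contDiff_const.add (contDiff_id.smul contDiff_const)
  have hb : block S₀ (skewBlock A) = A := by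
    ext z; rw [block_apply, skewBlock_apply]; simp
  have h1 : HasVel (fun t : ℝ => chart v (grPoint S₀ (v * expLie X t))) A := by
    have h := hasVel_chart_curve (S₀ := S₀) v X
    rw [show (X : H →L[ℂ] H) = skewBlock A from rfl, hb] at h
    exact h
  have h2 : HasVel (fun t : ℝ => pr S₀ (star (v : H →L[ℂ] H)
      (((v * expLie X t : UnitaryGroup H) : H →L[ℂ] H) ((x + t • y : S₀.toSubmodule) : H)))) y := by
    have h := hasVel_clm (pr S₀ ∘L star (v : H →L[ℂ] H)) (hasDerivAt_expLie v X x y)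
    have e : (pr S₀ ∘L star (v : H →L[ℂ] H)) ((v : H →L[ℂ] H) ((X : H →L[ℂ] H) x + y)) = y := by
      change pr S₀ (star (v : H →L[ℂ] H) ((v : H →L[ℂ] H) (skewBlock A x + y))) = y
      rw [star_coe_apply, skewBlock_apply]
      simp
    rw [e] at h
    exact h
  exact tangentMap_eq_of_hasVel hd
    (contMDiff_homPoint (contDiff_expLie v X) hc).continuous.continuousAt h1 h2 (fun t => rfl)

end HilbertGrassmann

end

open HilbertGrassmann

namespace HilbertGrassmann

variable {H : Type*} [NormedAddCommGroup H] [InnerProductSpace ℂ H] [CompleteSpace H]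
  {S₀ : ClosedSubmodule ℂ H}

/-! Let `J` be the map `(S, x) ↦ x` from the total space to `H`. In the trivialization given by a
unitary `u`, it reads `(A, y) ↦ u (y + A y)`, so it is smooth (`contMDiff_ambient`). A section is
determined by its composite with `J`, since its base point is prescribed; hence `F = J ∘ σ` is the
only possible choice and is smooth. By the chain rule `dF = dJ ∘ Tσ`, so the formula for `∇σ`
follows from an identity in which no section occurs: for every tangent vector `v` over `S`, the
vector part of `r (Φ v)` is `p_S (dJ v)`.

To prove that identity, write `v = [((u, X), (x, y))]`, with `S = u S₀`. Differentiating `u e^{tX}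
(x + t y)` at `0` gives `dJ v = u (X x + y)` (`tangentMap_ambient_homTangent`). On the other side,
`E_p X` commutes with `p`, so `e^{t E_p X}` preserves `S₀`. The curve that represents `Φ v`
therefore stays in the single fiber `S`, and `Φ v` is the vertical vector at `u x` in the direction
`u (E_p X x + y) = u (p X x + y)`, because `x` lies in `S₀`. This differs from `dJ v` by `u ((1 - p)
X x)`, which is orthogonal to `u S₀` because `u` is unitary. So the direction is `p_S (dJ v)`; this
is the content of `homTangent_condExp`, which rests on `homTangent_of_commute` and `proj_condExp`.

Three facts let the computation on representatives speak about `Φ` and `r` themselves, both defined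
by `Function.extend`. Every tangent vector has a representative (`homTangent_surjective`): in the
chart at the base point, the skew-adjoint operator with off-diagonal block `A`, together with `y`,
produces the coordinates `(A, y)`. The value of `Φ` does not depend on the representative
(`universalConnection_homTangent`), because the vertical vector found above involves only the base
point of `v` and `dJ v`. Finally `ε` is injective, `J` and `dJ` recovering its two arguments, so `r`
is determined on vertical vectors (`verticalToFiber_verticalLift`). -/

/-- The fiber part of the vertical component of a tangent vector `v` at `(S, x)` is the orthogonal
projection onto `S` of the image of `v` under the differential of `(S, x) ↦ x`. -/
lemma verticalToFiber_universalConnection (v : TangentBundle (totModel S₀) (Tot S₀)) :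
    verticalToFiber S₀ (universalConnection S₀ v)
      = ⟨v.proj.proj, v.proj.proj.space.toSubmodule.orthogonalProjectionOnto
          (tangentMap (totModel S₀) 𝓘(ℝ, H) (fun d : Tot S₀ => (d.2 : H)) v).2⟩ := by
  -- Surjectivity rules out the default branch of `universalConnection`, so the claim need only be
  -- checked on representatives.
  obtain ⟨⟨⟨u, X⟩, ⟨x, y⟩⟩, rfl⟩ := homTangent_surjective v
  -- `homTangent_condExp` exhibits `Φ v` as a value of `verticalLift`, which is what allows `r` to
  -- be evaluated. Both sides then project the same vector `u (X x + y)` onto the fiber through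
  -- `homPoint u x`.
  rw [universalConnection_homTangent, homTangent_condExp, verticalToFiber_verticalLift,
    tangentMap_ambient_homTangent, proj_homTangent]

end HilbertGrassmann

/-- The maps `σ` and `F` are total functions whose values outside `U` carry no meaning, so
uniqueness is equality on `U`. Openness of `U` makes the unrestricted tangent map of `σ` and the
derivative of `F` at a point of `U` the right ones, as they depend only on values near that point.
The membership witness `hS` lets the ambient vector `F S` be regarded as an element of the fiber
over `S`. -/
theorem proposition2p13 {H : Type*} [NormedAddCommGroup H] [InnerProductSpace ℂ H] [CompleteSpace H]
    (S₀ : ClosedSubmodule ℂ H) (U : Set (Gr S₀)) (hU : IsOpen U)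
    (σ : Gr S₀ → Tot S₀) (hsec : ∀ S ∈ U, (σ S).proj = S)
    (hσ : ContMDiffOn (grModel S₀) (totModel S₀) ∞ σ U) :
    ∃ F : Gr S₀ → H,
      ContMDiffOn (grModel S₀) 𝓘(ℝ, H) ∞ F U ∧
      (∀ S ∈ U, ∃ hS : F S ∈ S.space.toSubmodule, σ S = ⟨S, ⟨F S, hS⟩⟩) ∧
      (∀ F' : Gr S₀ → H,
        (∀ S ∈ U, ∃ hS : F' S ∈ S.space.toSubmodule, σ S = ⟨S, ⟨F' S, hS⟩⟩) → EqOn F' F U) ∧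
      ∀ S ∈ U, ∀ X : TangentSpace (grModel S₀) S,
        covariantDerivative (universalConnection S₀) σ ⟨S, X⟩
          = ⟨S, S.space.toSubmodule.orthogonalProjectionOnto
              (mfderiv (grModel S₀) 𝓘(ℝ, H) F S X)⟩ := by
  have hF : ∀ S ∈ U, ∃ hS : ((σ S).2 : H) ∈ S.space.toSubmodule,
      σ S = ⟨S, ⟨((σ S).2 : H), hS⟩⟩ := by
    intro S hS
    -- The base point is generalized to `T` because `S` occurs on both sides of `(σ S).proj = S`, so
    -- that equation cannot be eliminated directly.
    have hmem : ∀ T : Gr S₀, (σ S).proj = T → ((σ S).2 : H) ∈ T.space.toSubmodule := by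
      rintro _ rfl
      exact (σ S).2.2
    exact ⟨hmem S (hsec S hS), tot_ext (hsec S hS) rfl⟩
  -- The witness is `J ∘ σ`; its smoothness on `U` is that of a composite.
  refine ⟨fun S => ((σ S).2 : H), contMDiff_ambient.comp_contMDiffOn hσ, hF, ?_, ?_⟩
  · intro F' hF' S hS
    obtain ⟨_, h⟩ := hF' S hS
    -- Applying `J` to `σ S = (S, F' S)` leaves no freedom in the value of `F'`.
    exact (congrArg (fun d : Tot S₀ => (d.2 : H)) h).symm
  · intro S hS X
    -- Since `U` is a neighborhood of `S`, smoothness on `U` gives genuine differentiability at `S`,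
    -- which the chain rule for `tangentMap` needs.
    have hσS : MDifferentiableAt (grModel S₀) (totModel S₀) σ S :=
      (hσ.contMDiffAt (hU.mem_nhds hS)).mdifferentiableAt (by simp)
    -- Chain rule: the tangent map of `J ∘ σ` at `(S, X)` is that of `J` at `Tσ (S, X)`, and its
    -- vector part is by definition `dF (X)`.
    have hcomp := tangentMap_comp_at (p := (⟨S, X⟩ : TangentBundle (grModel S₀) (Gr S₀)))
      (contMDiff_ambient.mdifferentiableAt (by simp) : MDifferentiableAt (totModel S₀) 𝓘(ℝ, H)
        (fun d : Tot S₀ => (d.2 : H)) (σ S)) hσS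
    -- The vector `Tσ (S, X)` is based at the point `σ S` of the total space, which lies over `S` by
    -- the section property.
    have hproj : (tangentMap (grModel S₀) (totModel S₀) σ ⟨S, X⟩).proj.proj = S := hsec S hS
    rw [covariantDerivative, verticalToFiber_universalConnection, ← hcomp]
    -- The two points lie in fibers over base points that are only propositionally equal. Comparing
    -- base points and ambient vectors separately avoids transport between fibers; once the subspace
    -- is rewritten, both vectors are the same projection of `dF (X)`.
    refine tot_ext hproj ?_
    dsimp only
    rw [hproj]
    rfl
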